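/- **Theorem (Beck Gain for Graphs).** Let $d\ge 3$. There are positive finite constants $C_0,C_1,C_2,C_3$, depending only on $d$, such that the following holds with $\eta=\frac1{16d}$. *Setting.* Let $1\le q\le n$ be integers (for instance $q=\lfloor a n^{\varepsilon}\rfloor\geq 1$ with $0<a,\varepsilon<1$) and put $\rho=\sqrt q\,n^{-(d-1)/2}$. Divide $\{1,\dots,n\}$ into $q$ consecutive disjoint intervals $I_1,\dots,I_q$ of equal length (cardinalities differing by at most one if $q\nmid n$). Let $\mathbb H_n$ be the set of $\vec r\in\{0,1,2,\dots\}^d$ with $r_1+\dots+r_d=n$, and $\mathbb A_t=\{\vec r\in\mathbb H_n: r_1\in I_t\}$. For a dyadic interval $I$ let $h_I=-\mathbf 1_{I_{\rm left}}+\mathbf 1_{I_{\rm right}}$, and for a dyadic rectangle $R=R_1\times\dots\times R_d$ let $h_R(x)=\prod_j h_{R_j}(x_j)$. For each $\vec r\in\mathbb H_n$ let $f_{\vec r}=\sum_R\varepsilon_R h_R$ with arbitrary signs $\varepsilon_R\in\{\pm1\}$, the sum being over all dyadic rectangles $R\subset[0,1]^d$ with $|R_k|=2^{-r_k}$ for all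 $k$. *Graphs.* A $(d-1)$-colored graph $G$ consists of a vertex set $V\subset\{1,\dots,q\}$ and symmetric, loopless edge sets $E_2,\dots,E_d$ on $V$. A clique of color $j$ is a maximal set $Q\subset V$ with $(v,v')\in E_j$ for all $v\ne v'$ in $Q$. The graph $G$ is admissible if (i) for each color, the edge set decomposes into a union of disjoint cliques (i.e. distinct cliques of the same color are disjoint); (ii) if $Q_k$ is a clique of color $k$ for $k=2,\dots,d$, then $\bigcap_{k=2}^dQ_k$ has at most one element; (iii) every vertex lies in at least one clique with at least two elements. Let $X(G)$ be the set of tuples $(\vec r_v)_{v\in V}\in\prod_{v\in V}\mathbb A_v$ with $r_{v,j}=r_{v',j}$ whenever $(v,v')\in E_j$, and $\operatorname{SumProd}(X(G))=\sum_{(\vec r_v)\in X(G)}\prod_{v\in V}f_{\vec r_v}$. *Conclusion.* For all such $n$, $q$, $I_t$, $f_{\vec r}$, every admissible $G$ with vertex set $V$, and every $2<p<\infty$, $$\rho^{|V|}\,\bigl\|\operatorname{SumProd}(X(G))\bigr\|_{L^p([0,1]^d)}\le\bigl[C_0\,|V|^{C_1}\,p^{C_2}\,q^{C_3}\,n^{-\eta}\bigr]^{|V|}.$$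 -/

import Mathlib

open MeasureTheory
open scoped ENNReal

namespace BeckGain

/-- The half-open dyadic interval of length `2 ^ (-k)` at position `m`. -/
def dyadicInterval (k m : ℕ) : Set ℝ :=
  Set.Ico ((m : ℝ) / 2 ^ k) (((m : ℝ) + 1) / 2 ^ k)

/-- The `L^∞`-normalized Haar function of `dyadicInterval k m`: it is `-1` on the left half,
`1` on the right half, and `0` elsewhere. -/
noncomputable def haar (k m : ℕ) (x : ℝ) : ℝ :=
  -(dyadicInterval (k + 1) (2 * m)).indicator 1 x
    + (dyadicInterval (k + 1) (2 * m + 1)).indicator 1 x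

/-- The dyadic rectangles `R ⊆ [0,1]^d` with side lengths `2 ^ (-r 0), …, 2 ^ (-r (d-1))`,
given by the positions of their sides. -/
abbrev Rect {d : ℕ} (r : Fin d → ℕ) : Type := ∀ i : Fin d, Fin (2 ^ r i)

/-- The tensor product Haar function of a dyadic rectangle. -/
noncomputable def haarRect {d : ℕ} (r : Fin d → ℕ) (R : Rect r) (x : Fin d → ℝ) : ℝ :=
  ∏ i, haar (r i) (R i) (x i)

/-- `f` is an `r`-function with parameter `r`: a sum of `± h_R` over all dyadic rectangles `R`
in the unit cube with side lengths `2 ^ (-r i)`. -/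
def IsRFunction {d : ℕ} (r : Fin d → ℕ) (f : (Fin d → ℝ) → ℝ) : Prop :=
  ∃ ε : Rect r → ℝ, (∀ R, ε R = 1 ∨ ε R = -1) ∧ ∀ x, f x = ∑ R, ε R * haarRect r R x

/-- The set `ℍ_n` of vectors of nonnegative integers with coordinate sum `n`. -/
def hyperbolic (d n : ℕ) : Finset (Fin d → ℕ) := Finset.univ.piAntidiag n

/-- `SumProd`: the sum, over the tuples of vectors in `C`, of the products of the associated
functions. -/
noncomputable def sumProd {d : ℕ} {ι : Type} [Fintype ι]
    (f : (Fin d → ℕ) → (Fin d → ℝ) → ℝ) (C : Finset (ι → Fin d → ℕ)) (x : Fin d → ℝ) : ℝ :=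
  ∑ r ∈ C, ∏ v, f (r v) x

/-- `I` divides `{1, …, n}` into `q` consecutive disjoint intervals of equal length
(up to rounding, if `q` does not divide `n`). -/
structure IsEqualDivision (n q : ℕ) (I : Fin q → Finset ℕ) : Prop where
  ordConnected : ∀ t, (I t : Set ℕ).OrdConnected
  ordered : ∀ s t, s < t → ∀ i ∈ I s, ∀ j ∈ I t, i < j
  cover : ∀ j, (∃ t, j ∈ I t) ↔ 1 ≤ j ∧ j ≤ n
  card_le : ∀ s t, (I s).card ≤ (I t).card + 1

/-- `𝔸_t`: the vectors in `ℍ_n` whose first coordinate (the one with index `0`) lies in `I t`. -/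
noncomputable def blockVectors (d n : ℕ) {q : ℕ} (I : Fin q → Finset ℕ) (t : Fin q) :
    Finset (Fin d → ℕ) :=
  (hyperbolic d n).filter fun r => ∀ i : Fin d, (i : ℕ) = 0 → r i ∈ I t

/-- The `d - 1` colors: all coordinates but the first one. -/
abbrev Color (d : ℕ) : Type := {j : Fin d // (j : ℕ) ≠ 0}

/-- A `(d-1)`-colored graph: a vertex set inside the set of the `q` block indices, and for
each color a symmetric, loopless edge relation on it. -/
structure ColoredGraph (d q : ℕ) where
  V : Finset (Fin q)
  edges : Color d → SimpleGraph V

namespace ColoredGraph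

variable {d q : ℕ}

/-- A clique of color `j`: an inclusion-maximal set of pairwise `j`-adjacent vertices. -/
def IsColorClique (G : ColoredGraph d q) (j : Color d) (Q : Set G.V) : Prop :=
  Maximal (G.edges j).IsClique Q

/-- Admissible graphs. With the definition of clique above, a vertex without edges of color `j`
forms a one-point clique of color `j`; in the last condition the clique is therefore required to
be nontrivial (at least two vertices), i.e. the vertex takes part in some coincidence. -/
structure Admissible (G : ColoredGraph d q) : Prop where
  /-- In each color, the edge set is a disjoint union of cliques. -/
  decompose : ∀ (j : Color d) (Q Q' : Set G.V),
    G.IsColorClique j Q → G.IsColorClique j Q' → Q ≠ Q' → Disjoint Q Q'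
  /-- Cliques of all the different colors meet in at most one vertex. -/
  inter_subsingleton : ∀ Q : Color d → Set G.V,
    (∀ j, G.IsColorClique j (Q j)) → (⋂ j, Q j).Subsingleton
  /-- Every vertex is in at least one nontrivial clique. -/
  covered : ∀ v : G.V, ∃ (j : Color d) (Q : Set G.V),
    G.IsColorClique j Q ∧ Q.Nontrivial ∧ v ∈ Q

open Classical in
/-- `X(G)`: the tuples in `∏_{v ∈ V} 𝔸_v` such that each edge of color `j` is a coincidence in
the coordinate `j`. -/
noncomputable def tuples (G : ColoredGraph d q) (n : ℕ) (I : Fin q → Finset ℕ) :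
    Finset (G.V → Fin d → ℕ) :=
  (Fintype.piFinset fun v : G.V => blockVectors d n I v).filter fun r =>
    ∀ (j : Color d) (v v' : G.V), (G.edges j).Adj v v' → r v j = r v' j

end ColoredGraph

/-- The `L²` normalization `ρ = √q n^{-(d-1)/2}`. -/
noncomputable def rho (d n q : ℕ) : ℝ :=
  Real.sqrt q * (n : ℝ) ^ (-(((d : ℝ) - 1) / 2))

end BeckGain

/-! Admissibility makes "equal or adjacent" an equivalence relation in each color, and pigeonhole
gives a color `j` whose nontrivial cliques cover at least `|V| / (d - 1)` vertices. Once the values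
of the coordinates shared in the other colors are fixed, the sum factors over the cliques of color
`j`. A nontrivial clique has one common value for at least two vertices, so the number of fixings is
at most `n + 1` to half the number of shared coordinates (`card_sharedValues_sq_le`). This is the
square-root cost those coordinates would have if free, so nothing is lost, and the benchmark is `n ^
((d - 1) / 2)` per vertex, which `ρ` cancels up to `√q`. It remains to gain a power of `n` for each
vertex in a nontrivial clique of color `j` (`eLpNorm_clique_le`).

Norms are estimated with digit flips in place of martingales. Flipping a binary digit of the
coordinate `x i` preserves the measure, negates the `f r` whose `r i` is the level of that digit,
and fixes those with smaller `r i`. With a type 2 inequality, each free coordinate costs `√(n + 1)`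
up to factors polynomial in the exponent (`eLpNorm_vecSum_le`).

For a clique with at least three vertices, the triangle inequality over the common value costs `n +
1`, less than the benchmark `(n + 1) ^ (3 / 2)`. For two vertices this yields nothing, and the
separation of the first coordinates is used instead (`eLpNorm_pair_sq_le`). Flips in the first
coordinate give a square function `∑ m, (∑ a, F a * A a m) ^ 2`, at most `|F|²` times the
Hilbert–Schmidt norm of `A Aᵀ`. The latter is the squared Schatten 4-norm of `A`, which again has
type 2 (`boxSq_smooth`). This reduces matters to slices on which `A Aᵀ` is diagonal, where the norm
is `√(n + 1)` instead of `n + 1`. -/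

namespace BeckGain

/-! ### Scalar inequalities for even powers under symmetric steps. -/

section Algebra

/-- Even and odd parts of a power of a binomial are monotone in the two terms. -/
theorem abs_even_odd_pow_le {a b A B : ℝ} (ha : |a| ≤ A) (hb : |b| ≤ B) (k : ℕ) :
    |(a + b) ^ k + (a - b) ^ k| ≤ (A + B) ^ k + (A - B) ^ k ∧
      |(a + b) ^ k - (a - b) ^ k| ≤ (A + B) ^ k - (A - B) ^ k := by
  have hA : 0 ≤ A := (abs_nonneg a).trans ha
  have hB : 0 ≤ B := (abs_nonneg b).trans hb
  induction k with
  | zero => norm_num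
  | succ k ih =>
    obtain ⟨h1, h2⟩ := ih
    set s := (a + b) ^ k + (a - b) ^ k
    set t := (a + b) ^ k - (a - b) ^ k
    set S := (A + B) ^ k + (A - B) ^ k
    set T := (A + B) ^ k - (A - B) ^ k
    have e1 : (a + b) ^ (k + 1) + (a - b) ^ (k + 1) = a * s + b * t := by simp only [s, t]; ring
    have e2 : (a + b) ^ (k + 1) - (a - b) ^ (k + 1) = a * t + b * s := by simp only [s, t]; ring
    have e3 : (A + B) ^ (k + 1) + (A - B) ^ (k + 1) = A * S + B * T := by simp only [S, T]; ring
    have e4 : (A + B) ^ (k + 1) - (A - B) ^ (k + 1) = A * T + B * S := by simp only [S, T]; ring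
    rw [e1, e2, e3, e4]
    constructor
    · refine (abs_add_le _ _).trans ?_
      rw [abs_mul, abs_mul]
      gcongr
    · refine (abs_add_le _ _).trans ?_
      rw [abs_mul, abs_mul]
      gcongr

/-- The scalar smoothness inequality. -/
theorem add_pow_add_sub_pow_le {x y c : ℝ} (K : ℕ) (hc : 4 * (K : ℝ) + 1 ≤ c) :
    (x + y) ^ (2 * K) + (x - y) ^ (2 * K) ≤ 2 * (x ^ 2 + c * y ^ 2) ^ K := by
  have hc1 : 1 ≤ c := by have : (0 : ℝ) ≤ K := by positivity
                         linarith
  set z := x ^ 2 + c * y ^ 2 with hz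
  have hz1 : x ^ 2 + y ^ 2 ≤ z := by nlinarith [sq_nonneg y]
  have hz0 : 0 ≤ z := by positivity
  -- The recursion couples even and odd parts, so both are bounded together. The second bound stands
  -- for `4k (xy)² z ^ (k - 1)`, with the factor `z` moved to the left. It makes the mixed term at
  -- most `(c - 1) y² z ^ k`, just what is missing between `x² + y²` and `z`.
  suffices h : ∀ k : ℕ, k ≤ K →
      (x + y) ^ (2 * k) + (x - y) ^ (2 * k) ≤ 2 * z ^ k ∧
      x * y * ((x + y) ^ (2 * k) - (x - y) ^ (2 * k)) * z ≤ 4 * k * (x * y) ^ 2 * z ^ k from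
    (h K le_rfl).1
  intro k
  induction k with
  | zero => intro _; norm_num
  | succ k ih =>
    intro hk
    obtain ⟨h1, h2⟩ := ih (by omega)
    have hk' : (k : ℝ) + 1 ≤ K := by exact_mod_cast hk
    set s := (x + y) ^ (2 * k) + (x - y) ^ (2 * k) with hs
    set t := (x + y) ^ (2 * k) - (x - y) ^ (2 * k) with ht
    have e1 : (x + y) ^ (2 * (k + 1)) + (x - y) ^ (2 * (k + 1))
        = (x ^ 2 + y ^ 2) * s + 2 * (x * y * t) := by simp only [s, t]; ring
    have e2 : (x + y) ^ (2 * (k + 1)) - (x - y) ^ (2 * (k + 1))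
        = (x ^ 2 + y ^ 2) * t + 2 * (x * y) * s := by simp only [s, t]; ring
    have hs0 : 0 ≤ s := by
      have := (even_two_mul k).pow_nonneg (x + y)
      have := (even_two_mul k).pow_nonneg (x - y)
      positivity
    rw [e1, e2]
    rcases hz0.eq_or_lt with hz00 | hzpos
    · have hx : x = 0 := by nlinarith [sq_nonneg x, sq_nonneg y]
      have hy : y = 0 := by nlinarith [sq_nonneg x, sq_nonneg y]
      simp [hx, hy, ← hz00]
    · have hzk : 0 ≤ z ^ k := by positivity
      have h3 : x * y * t ≤ (c - 1) * y ^ 2 * z ^ k := by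
        refine le_of_mul_le_mul_right (h2.trans ?_) hzpos
        have : 4 * (k : ℝ) * (x * y) ^ 2 ≤ (c - 1) * y ^ 2 * z := by
          have : (x * y) ^ 2 ≤ y ^ 2 * z := by nlinarith [sq_nonneg x, sq_nonneg y]
          have h4 : 4 * (k : ℝ) ≤ c - 1 := by linarith
          calc 4 * (k : ℝ) * (x * y) ^ 2 ≤ 4 * (k : ℝ) * (y ^ 2 * z) := by gcongr
            _ ≤ (c - 1) * (y ^ 2 * z) := by gcongr
            _ = _ := by ring
        nlinarith
      refine ⟨?_, ?_⟩
      · have : (x ^ 2 + y ^ 2) * s ≤ (x ^ 2 + y ^ 2) * (2 * z ^ k) := by gcongr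
        have e : z ^ (k + 1) = (x ^ 2 + c * y ^ 2) * z ^ k := by rw [pow_succ, mul_comm]
        rw [e]; linarith
      · have h5 : (x ^ 2 + y ^ 2) * (x * y * t * z) ≤ z * (4 * k * (x * y) ^ 2 * z ^ k) := by
          calc _ ≤ (x ^ 2 + y ^ 2) * (4 * k * (x * y) ^ 2 * z ^ k) := by gcongr
            _ ≤ _ := by gcongr
        have h6 : (x * y) ^ 2 * s * z ≤ (x * y) ^ 2 * (2 * z ^ k) * z := by gcongr
        push_cast
        rw [pow_succ z k]
        linarith

/-- The increment of an even power under a symmetric step is controlled by the square of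
the step. -/
theorem even_pow_increment_le (x y : ℝ) (k : ℕ) :
    ((x + y) ^ (2 * (k + 1)) + (x - y) ^ (2 * (k + 1))) / 2 - x ^ (2 * (k + 1)) ≤
      2 * ((k : ℝ) + 1) ^ 2 * y ^ 2 * (((x + y) ^ (2 * k) + (x - y) ^ (2 * k)) / 2) := by
  have hs : ∀ k : ℕ, 0 ≤ ((x + y) ^ (2 * k) + (x - y) ^ (2 * k)) / 2 := fun k => by
    have := (even_two_mul k).pow_nonneg (x + y)
    have := (even_two_mul k).pow_nonneg (x - y)
    positivity
  have e1 : ∀ k : ℕ, ((x + y) ^ (2 * (k + 1)) + (x - y) ^ (2 * (k + 1))) / 2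
      = (x ^ 2 + y ^ 2) * (((x + y) ^ (2 * k) + (x - y) ^ (2 * k)) / 2)
        + 2 * (x * y * (((x + y) ^ (2 * k) - (x - y) ^ (2 * k)) / 2)) := fun k => by ring
  have e2 : ∀ k : ℕ, x * y * (((x + y) ^ (2 * (k + 1)) - (x - y) ^ (2 * (k + 1))) / 2)
      = (x ^ 2 + y ^ 2) * (x * y * (((x + y) ^ (2 * k) - (x - y) ^ (2 * k)) / 2))
        + 2 * (x * y) ^ 2 * (((x + y) ^ (2 * k) + (x - y) ^ (2 * k)) / 2) := fun k => by ring
  -- The mixed term in the recursion is nonnegative and of second order in `y`.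
  have ht : ∀ k : ℕ, 0 ≤ x * y * (((x + y) ^ (2 * k) - (x - y) ^ (2 * k)) / 2) ∧
      x * y * (((x + y) ^ (2 * k) - (x - y) ^ (2 * k)) / 2) ≤
        2 * k * y ^ 2 * (((x + y) ^ (2 * k) + (x - y) ^ (2 * k)) / 2) := by
    intro k
    induction k with
    | zero => norm_num
    | succ k ih =>
      obtain ⟨h1, h2⟩ := ih
      have h0 := hs k
      rw [e2 k]
      refine ⟨by positivity, ?_⟩
      rw [e1 k]
      set s := ((x + y) ^ (2 * k) + (x - y) ^ (2 * k)) / 2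
      set t := x * y * (((x + y) ^ (2 * k) - (x - y) ^ (2 * k)) / 2)
      have h3 : (x ^ 2 + y ^ 2) * t ≤ (x ^ 2 + y ^ 2) * (2 * k * y ^ 2 * s) := by gcongr
      have h4 : 0 ≤ 2 * ((k : ℝ) + 1) * y ^ 2 * (2 * t) := by positivity
      have h5 : 0 ≤ 2 * (y ^ 2 * y ^ 2 * s) := by positivity
      push_cast
      linarith
  induction k with
  | zero => norm_num; nlinarith [sq_nonneg y]
  | succ k ih =>
    have h1 := e1 (k + 1)
    have h2 := e1 k
    have h3 := ht (k + 1)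
    have h4 := ht k
    have h5 := hs k
    have h6 := hs (k + 1)
    rw [h1]
    set s' := ((x + y) ^ (2 * (k + 1)) + (x - y) ^ (2 * (k + 1))) / 2
    set s := ((x + y) ^ (2 * k) + (x - y) ^ (2 * k)) / 2
    set t' := x * y * (((x + y) ^ (2 * (k + 1)) - (x - y) ^ (2 * (k + 1))) / 2)
    set t := x * y * (((x + y) ^ (2 * k) - (x - y) ^ (2 * k)) / 2)
    -- This absorbs the factor `x²` of the recursion; the induction closes because `2(k+1)² + 4(k+1)
    -- + 1 ≤ 2(k+2)²`.
    have h7 : x ^ 2 * s ≤ s' := by nlinarith [mul_nonneg (sq_nonneg y) h5, h4.1]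
    have h8 : x ^ 2 * (s' - x ^ (2 * (k + 1))) ≤ x ^ 2 * (2 * ((k : ℝ) + 1) ^ 2 * y ^ 2 * s) := by
      gcongr
    have h9 : 2 * ((k : ℝ) + 1) ^ 2 * y ^ 2 * (x ^ 2 * s) ≤
        2 * ((k : ℝ) + 1) ^ 2 * y ^ 2 * s' := by gcongr
    have h10 : 0 ≤ y ^ 2 * s' := by positivity
    have h11 : x ^ (2 * (k + 1 + 1)) = x ^ 2 * x ^ (2 * (k + 1)) := by ring
    rw [h11]
    push_cast at h3 ⊢
    nlinarith [h3.2]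

/-- Young's inequality for powers. -/
theorem young_pow {x y : ℝ} (hx : 0 ≤ x) (hy : 0 ≤ y) (k : ℕ) :
    ((k : ℝ) + 1) * (x ^ k * y) ≤ k * x ^ (k + 1) + y ^ (k + 1) := by
  induction k with
  | zero => norm_num
  | succ k ih =>
    have h1 : x * (((k : ℝ) + 1) * (x ^ k * y)) ≤ x * (k * x ^ (k + 1) + y ^ (k + 1)) := by gcongr
    have h2 : 0 ≤ (x - y) * (x ^ (k + 1) - y ^ (k + 1)) := by
      rcases le_total x y with h | h
      · exact mul_nonneg_of_nonpos_of_nonpos (by linarith)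
          (by have := pow_le_pow_left₀ hx h (k + 1); linarith)
      · exact mul_nonneg (by linarith) (by have := pow_le_pow_left₀ hy h (k + 1); linarith)
    push_cast
    simp only [pow_succ] at *
    nlinarith

end Algebra

/-! ### The Schatten 4-norm and its type 2 inequality. -/

section Box

variable {α β : Type*} [Fintype α] [Fintype β]

/-- The Hilbert–Schmidt norm of `A Aᵀ`, i.e. the square of the Schatten 4-norm of `A`. -/
noncomputable def boxSq (A : α → β → ℝ) : ℝ :=
  Real.sqrt (∑ a, ∑ a', (∑ s, A a s * A a' s) ^ 2)

theorem boxSq_nonneg (A : α → β → ℝ) : 0 ≤ boxSq A := Real.sqrt_nonneg _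

theorem boxSq_sq (A : α → β → ℝ) :
    boxSq A ^ 2 = ∑ a, ∑ a', (∑ s, A a s * A a' s) ^ 2 :=
  Real.sq_sqrt (by positivity)

theorem sum_sum_mul_sq_le (P R : α → β → ℝ) :
    (∑ a, ∑ s, P a s * R a s) ^ 2 ≤ (∑ a, ∑ s, P a s ^ 2) * ∑ a, ∑ s, R a s ^ 2 := by
  simp only [← Fintype.sum_prod_type']
  exact Finset.sum_mul_sq_le_sq_mul_sq _ _ _

/-- The Hilbert–Schmidt inner product of `A Bᵀ` and `C Eᵀ` can be computed from `Aᵀ C`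
and `Bᵀ E`. -/
theorem sum_gram_swap (A B C E : α → β → ℝ) :
    ∑ a, ∑ a', (∑ s, A a s * B a' s) * (∑ s, C a s * E a' s) =
      ∑ s, ∑ s', (∑ a, A a s * C a s') * (∑ a, B a s * E a s') := by
  simp only [Finset.sum_mul_sum]
  calc _ = ∑ a, ∑ s, ∑ a', ∑ s', A a s * B a' s * (C a s' * E a' s') := by
        refine Finset.sum_congr rfl fun a _ => ?_
        rw [Finset.sum_comm]
    _ = ∑ s, ∑ a, ∑ a', ∑ s', A a s * B a' s * (C a s' * E a' s') := Finset.sum_comm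
    _ = ∑ s, ∑ a, ∑ s', ∑ a', A a s * B a' s * (C a s' * E a' s') := by
        refine Finset.sum_congr rfl fun s _ => Finset.sum_congr rfl fun a _ => Finset.sum_comm
    _ = ∑ s, ∑ s', ∑ a, ∑ a', A a s * B a' s * (C a s' * E a' s') := by
        refine Finset.sum_congr rfl fun s _ => Finset.sum_comm
    _ = _ := by
        refine Finset.sum_congr rfl fun s _ => Finset.sum_congr rfl fun s' _ =>
          Finset.sum_congr rfl fun a _ => Finset.sum_congr rfl fun a' _ => ?_
        ring

theorem boxSq_sq_transpose (A : α → β → ℝ) :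
    boxSq A ^ 2 = ∑ s, ∑ s', (∑ a, A a s * A a s') ^ 2 := by
  rw [boxSq_sq]
  have := sum_gram_swap A A A A
  simp only [← sq] at this
  exact this

/-- The squared Hilbert–Schmidt norm of `A Bᵀ` is the inner product of `Aᵀ A` and `Bᵀ B`, to which
Cauchy–Schwarz applies. -/
theorem sum_mixed_gram_sq_le (A B : α → β → ℝ) :
    ∑ a, ∑ a', (∑ s, A a s * B a' s) ^ 2 ≤ boxSq A * boxSq B := by
  have h := sum_gram_swap A B A B
  simp only [← sq] at h
  rw [h]
  refine abs_le_of_sq_le_sq' ?_ (mul_nonneg (boxSq_nonneg A) (boxSq_nonneg B)) |>.2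
  rw [mul_pow, boxSq_sq_transpose, boxSq_sq_transpose]
  exact sum_sum_mul_sq_le _ _

theorem boxSq_zero : boxSq (0 : α → β → ℝ) = 0 := by simp [boxSq]

/-- The vector `A ᵀ F` is bounded through the Schatten norm of `A`. -/
theorem sum_sq_apply_le (F : α → ℝ) (A : α → β → ℝ) :
    ∑ s, (∑ a, F a * A a s) ^ 2 ≤ (∑ a, F a ^ 2) * boxSq A := by
  -- `|Aᵀ F|²` is the inner product of the rank one matrix `F Fᵀ` with `A Aᵀ`.
  have h : ∑ s, (∑ a, F a * A a s) ^ 2 =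
      ∑ a, ∑ a', (F a * F a') * ∑ s, A a s * A a' s := by
    have h1 : ∀ s, (∑ a, F a * A a s) ^ 2 =
        ∑ a, ∑ a', (F a * F a') * (A a s * A a' s) := fun s => by
      rw [sq, Finset.sum_mul_sum]
      refine Finset.sum_congr rfl fun a _ => Finset.sum_congr rfl fun a' _ => ?_
      ring
    simp_rw [h1, Finset.mul_sum]
    rw [Finset.sum_comm]
    exact Finset.sum_congr rfl fun a _ => Finset.sum_comm
  rw [h]
  refine abs_le_of_sq_le_sq' ?_ (mul_nonneg (by positivity) (boxSq_nonneg A)) |>.2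
  rw [mul_pow, boxSq_sq]
  refine (sum_sum_mul_sq_le _ _).trans (le_of_eq ?_)
  congr 1
  rw [sq, Finset.sum_mul_sum]
  simp only [mul_pow]

/-- The Gram matrices of `A ± E` are `P ± R`, with `P = A Aᵀ + E Eᵀ` and `R` the cross terms. If
`X`, `Y` are the Schatten 4-norms of `A`, `E`, then `P` and `R` have Hilbert–Schmidt norms at most
`X² + Y²` and `2XY`, which are the even and odd parts of `(X ± Y)²`. By monotonicity of even parts,
the matrix case is dominated by the scalar one with exponent `4k`; hence the constant `4 (2k) + 1`.
-/
theorem boxSq_smooth (A E : α → β → ℝ) {c : ℝ} (k : ℕ) (hc : 8 * (k : ℝ) + 1 ≤ c) :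
    boxSq (A + E) ^ (2 * k) + boxSq (A - E) ^ (2 * k) ≤
      2 * (boxSq A + c * boxSq E) ^ (2 * k) := by
  set P : α → α → ℝ := fun a a' => (∑ s, A a s * A a' s) + ∑ s, E a s * E a' s with hP
  set R : α → α → ℝ := fun a a' => (∑ s, A a s * E a' s) + ∑ s, E a s * A a' s with hR
  set X := Real.sqrt (boxSq A)
  set Y := Real.sqrt (boxSq E)
  have hX : X ^ 2 = boxSq A := Real.sq_sqrt (boxSq_nonneg A)
  have hY : Y ^ 2 = boxSq E := Real.sq_sqrt (boxSq_nonneg E)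
  have hX0 : 0 ≤ X := Real.sqrt_nonneg _
  have hY0 : 0 ≤ Y := Real.sqrt_nonneg _
  set p := ∑ a, ∑ a', P a a' ^ 2 with hp
  set r := ∑ a, ∑ a', R a a' ^ 2 with hr
  set o := ∑ a, ∑ a', P a a' * R a a' with ho
  have e1 : boxSq (A + E) ^ 2 = (p + r) + 2 * o := by
    rw [boxSq_sq, hp, hr, ho, Finset.mul_sum, ← Finset.sum_add_distrib, ← Finset.sum_add_distrib]
    refine Finset.sum_congr rfl fun a _ => ?_
    rw [Finset.mul_sum, ← Finset.sum_add_distrib, ← Finset.sum_add_distrib]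
    refine Finset.sum_congr rfl fun a' _ => ?_
    have : ∑ s, (A + E) a s * (A + E) a' s = P a a' + R a a' := by
      simp only [hP, hR, ← Finset.sum_add_distrib, Pi.add_apply]
      refine Finset.sum_congr rfl fun s _ => ?_
      ring
    rw [this]; ring
  have e2 : boxSq (A - E) ^ 2 = (p + r) - 2 * o := by
    rw [boxSq_sq, hp, hr, ho, Finset.mul_sum, ← Finset.sum_add_distrib, ← Finset.sum_sub_distrib]
    refine Finset.sum_congr rfl fun a _ => ?_
    rw [Finset.mul_sum, ← Finset.sum_add_distrib, ← Finset.sum_sub_distrib]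
    refine Finset.sum_congr rfl fun a' _ => ?_
    have : ∑ s, (A - E) a s * (A - E) a' s = P a a' - R a a' := by
      simp only [hP, hR, ← Finset.sum_add_distrib, ← Finset.sum_sub_distrib, Pi.sub_apply]
      refine Finset.sum_congr rfl fun s _ => ?_
      ring
    rw [this]; ring
  -- the triangle inequality in the Hilbert–Schmidt norm
  have tri : ∀ (M N : α → α → ℝ) (m n : ℝ), 0 ≤ m → 0 ≤ n → ∑ a, ∑ a', M a a' ^ 2 ≤ m ^ 2 →
      ∑ a, ∑ a', N a a' ^ 2 ≤ n ^ 2 → ∑ a, ∑ a', (M a a' + N a a') ^ 2 ≤ (m + n) ^ 2 := by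
    intro M N m n hm hn h1 h2
    have h3 : ∑ a, ∑ a', M a a' * N a a' ≤ m * n := by
      refine abs_le_of_sq_le_sq' ?_ (by positivity) |>.2
      refine (sum_sum_mul_sq_le M N).trans ?_
      rw [mul_pow]; gcongr
    have h4 : ∑ a, ∑ a', (M a a' + N a a') ^ 2 = ∑ a, ∑ a', M a a' ^ 2 + ∑ a, ∑ a', N a a' ^ 2
        + 2 * ∑ a, ∑ a', M a a' * N a a' := by
      simp only [Finset.mul_sum, ← Finset.sum_add_distrib]
      refine Finset.sum_congr rfl fun a _ => Finset.sum_congr rfl fun a' _ => ?_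
      ring
    rw [h4]; nlinarith
  have hp' : p ≤ (X ^ 2 + Y ^ 2) ^ 2 := by
    refine tri _ _ _ _ (by positivity) (by positivity) ?_ ?_
    · rw [hX, boxSq_sq]
    · rw [hY, boxSq_sq]
  have hr' : r ≤ (X * Y + X * Y) ^ 2 := by
    refine tri _ _ _ _ (by positivity) (by positivity) ?_ ?_
    · rw [mul_pow, hX, hY]; exact sum_mixed_gram_sq_le A E
    · rw [mul_pow, hX, hY, mul_comm]; exact sum_mixed_gram_sq_le E A
  have hp0 : 0 ≤ p := by positivity
  have hr0 : 0 ≤ r := by positivity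
  have ho' : |o| ≤ (X ^ 2 + Y ^ 2) * (X * Y + X * Y) := by
    refine abs_le_of_sq_le_sq ?_ (by positivity)
    refine (sum_sum_mul_sq_le P R).trans ?_
    rw [mul_pow]; gcongr
  have h1 : |p + r| ≤ (X ^ 2 + Y ^ 2) ^ 2 + (X * Y + X * Y) ^ 2 := by
    rw [abs_of_nonneg (by positivity)]; gcongr
  have h2 : |2 * o| ≤ 2 * ((X ^ 2 + Y ^ 2) * (X * Y + X * Y)) := by
    rw [abs_mul, abs_two]; gcongr
  have h3 := (le_abs_self _).trans (abs_even_odd_pow_le h1 h2 k).1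
  rw [pow_mul, pow_mul, e1, e2]
  refine h3.trans ?_
  have h4 := add_pow_add_sub_pow_le (x := X) (y := Y) (c := c) (2 * k) (by push_cast; linarith)
  rw [hX, hY] at h4
  refine le_trans (le_of_eq ?_) h4
  rw [show 2 * (2 * k) = 4 * k by ring, pow_mul, pow_mul]
  ring

end Box

/-! ### Norms under sign-changing symmetries, the square function and Hölder's inequality. -/

section Analysis

variable {Ω : Type*} [MeasurableSpace Ω] {μ : Measure Ω}

theorem eLpNorm_natCast_pow (g : Ω → ℝ) {k : ℕ} (hk : k ≠ 0) :
    eLpNorm g (k : ℝ≥0∞) μ ^ k = ∫⁻ x, ENNReal.ofReal (|g x| ^ k) ∂μ := by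
  have h := eLpNorm_nnreal_pow_eq_lintegral (f := g) (μ := μ) (p := (k : NNReal))
    (by exact_mod_cast hk)
  simp only [NNReal.coe_natCast, ENNReal.rpow_natCast, ENNReal.coe_natCast] at h
  rw [h]
  refine lintegral_congr fun x => ?_
  rw [ENNReal.ofReal_pow (abs_nonneg _), ← Real.norm_eq_abs, ofReal_norm]

/-- A bounded measurable function. -/
structure BddMeasurable (g : Ω → ℝ) : Prop where
  measurable : Measurable g
  bdd : ∃ B, ∀ x, |g x| ≤ B

namespace BddMeasurable

variable {g h : Ω → ℝ}

theorem const (a : ℝ) : BddMeasurable fun _ : Ω => a := ⟨measurable_const, |a|, fun _ => le_rfl⟩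

theorem add (hg : BddMeasurable g) (hh : BddMeasurable h) :
    BddMeasurable fun x => g x + h x := by
  obtain ⟨m, B, hB⟩ := hg
  obtain ⟨m', B', hB'⟩ := hh
  exact ⟨m.add m', B + B', fun x => (abs_add_le _ _).trans (add_le_add (hB x) (hB' x))⟩

theorem mul (hg : BddMeasurable g) (hh : BddMeasurable h) :
    BddMeasurable fun x => g x * h x := by
  obtain ⟨m, B, hB⟩ := hg
  obtain ⟨m', B', hB'⟩ := hh
  refine ⟨m.mul m', B * B', fun x => ?_⟩
  rw [abs_mul]
  exact mul_le_mul (hB x) (hB' x) (abs_nonneg _) ((abs_nonneg _).trans (hB x))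

theorem pow (hg : BddMeasurable g) (k : ℕ) : BddMeasurable fun x => g x ^ k := by
  obtain ⟨m, B, hB⟩ := hg
  refine ⟨m.pow_const k, B ^ k, fun x => ?_⟩
  rw [abs_pow]
  exact pow_le_pow_left₀ (abs_nonneg _) (hB x) k

theorem sum {ι : Type*} {s : Finset ι} {g : ι → Ω → ℝ} (hg : ∀ i ∈ s, BddMeasurable (g i)) :
    BddMeasurable fun x => ∑ i ∈ s, g i x := by
  classical
  induction s using Finset.induction_on with
  | empty => simpa using const 0
  | insert i s hi ih =>
    simp only [Finset.sum_insert hi]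
    exact (hg i (Finset.mem_insert_self _ _)).add
      (ih fun j hj => hg j (Finset.mem_insert_of_mem hj))

theorem prod {ι : Type*} {s : Finset ι} {g : ι → Ω → ℝ} (hg : ∀ i ∈ s, BddMeasurable (g i)) :
    BddMeasurable fun x => ∏ i ∈ s, g i x := by
  classical
  induction s using Finset.induction_on with
  | empty => simpa using const 1
  | insert i s hi ih =>
    simp only [Finset.prod_insert hi]
    exact (hg i (Finset.mem_insert_self _ _)).mul
      (ih fun j hj => hg j (Finset.mem_insert_of_mem hj))

theorem sqrt (hg : BddMeasurable g) : BddMeasurable fun x => Real.sqrt (g x) := by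
  obtain ⟨m, B, hB⟩ := hg
  refine ⟨m.sqrt, Real.sqrt B, fun x => ?_⟩
  rw [abs_of_nonneg (Real.sqrt_nonneg _)]
  exact Real.sqrt_le_sqrt ((le_abs_self _).trans (hB x))

theorem comp {θ : Ω → Ω} (hg : BddMeasurable g) (hθ : Measurable θ) :
    BddMeasurable fun x => g (θ x) := by
  obtain ⟨m, B, hB⟩ := hg
  exact ⟨m.comp hθ, B, fun x => hB _⟩

theorem integrable [IsFiniteMeasure μ] (hg : BddMeasurable g) : Integrable g μ := by
  obtain ⟨m, B, hB⟩ := hg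
  exact Integrable.of_bound m.aestronglyMeasurable B (Filter.Eventually.of_forall hB)

theorem aesm (hg : BddMeasurable g) : AEStronglyMeasurable g μ :=
  hg.measurable.aestronglyMeasurable

end BddMeasurable

theorem eLpNorm_natCast_pow_eq_integral [IsFiniteMeasure μ] {g : Ω → ℝ} (hg : BddMeasurable g)
    {k : ℕ} (hk : k ≠ 0) (h0 : ∀ x, |g x| ^ k = g x ^ k) :
    eLpNorm g (k : ℝ≥0∞) μ ^ k = ENNReal.ofReal (∫ x, g x ^ k ∂μ) := by
  rw [eLpNorm_natCast_pow g hk, ofReal_integral_eq_lintegral_ofReal (hg.pow k).integrable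
    (Filter.Eventually.of_forall fun x => by simp only [Pi.zero_apply]; rw [← h0]; positivity)]
  simp only [h0]

/-- If `u ^ K`, averaged over a measure preserving map, is at most `w ^ K`, then `u` has at most
the `L ^ K` norm of `w`. -/
theorem eLpNorm_le_of_average_le {u w : Ω → ℝ} {θ : Ω → Ω} (hθ : MeasurePreserving θ μ μ)
    (hu : Measurable u) (hu0 : ∀ x, 0 ≤ u x) (hw0 : ∀ x, 0 ≤ w x) {K : ℕ} (hK : K ≠ 0)
    (h : ∀ x, u x ^ K + u (θ x) ^ K ≤ 2 * w x ^ K) :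
    eLpNorm u (K : ℝ≥0∞) μ ≤ eLpNorm w (K : ℝ≥0∞) μ := by
  refine (ENNReal.pow_le_pow_left_iff hK).1 ?_
  rw [eLpNorm_natCast_pow u hK, eLpNorm_natCast_pow w hK]
  simp only [abs_of_nonneg (hu0 _), abs_of_nonneg (hw0 _)]
  have hm : Measurable fun x => ENNReal.ofReal (u x ^ K) := (hu.pow_const K).ennreal_ofReal
  have h1 : ∫⁻ x, ENNReal.ofReal (u (θ x) ^ K) ∂μ = ∫⁻ x, ENNReal.ofReal (u x ^ K) ∂μ :=
    hθ.lintegral_comp hm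
  have h2 : 2 * ∫⁻ x, ENNReal.ofReal (u x ^ K) ∂μ ≤ 2 * ∫⁻ x, ENNReal.ofReal (w x ^ K) ∂μ := by
    calc 2 * ∫⁻ x, ENNReal.ofReal (u x ^ K) ∂μ
        = ∫⁻ x, ENNReal.ofReal (u x ^ K) ∂μ + ∫⁻ x, ENNReal.ofReal (u (θ x) ^ K) ∂μ := by
          rw [h1, two_mul]
      _ = ∫⁻ x, ENNReal.ofReal (u x ^ K) + ENNReal.ofReal (u (θ x) ^ K) ∂μ :=
          (lintegral_add_left hm _).symm
      _ ≤ ∫⁻ x, 2 * ENNReal.ofReal (w x ^ K) ∂μ := by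
          refine lintegral_mono fun x => ?_
          rw [← ENNReal.ofReal_add (pow_nonneg (hu0 _) _) (pow_nonneg (hu0 _) _)]
          refine (ENNReal.ofReal_le_ofReal (h x)).trans (le_of_eq ?_)
          rw [ENNReal.ofReal_mul (by norm_num)]
          norm_num
      _ = _ := lintegral_const_mul' _ _ (by norm_num)
  exact (ENNReal.mul_le_mul_iff_right (by norm_num) (by norm_num)).1 h2

/-- The square function inequality in `L ^ {2 (k + 1)}` for differences which are odd under
measure preserving maps. -/
theorem integral_even_pow_le_square_function [IsFiniteMeasure μ] {D : ℕ → Ω → ℝ}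
    {θ : ℕ → Ω → Ω} {W : Ω → ℝ} (hθ : ∀ m, MeasurePreserving (θ m) μ μ)
    (hD : ∀ m, BddMeasurable (D m)) (hodd : ∀ m x, D m (θ m x) = -D m x)
    (hinv : ∀ i m x, i < m → D i (θ m x) = D i x) (hW : BddMeasurable W) (M : ℕ)
    (hDW : ∀ x, ∑ m ∈ Finset.range M, D m x ^ 2 ≤ W x) (k : ℕ) :
    ∫ x, (∑ m ∈ Finset.range M, D m x) ^ (2 * (k + 1)) ∂μ ≤
      (2 * ((k : ℝ) + 1) ^ 2) ^ (k + 1) * ∫ x, W x ^ (k + 1) ∂μ := by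
  set C : ℝ := 2 * ((k : ℝ) + 1) ^ 2 with hC
  have hC0 : 0 ≤ C := by positivity
  set X : ℕ → Ω → ℝ := fun m x => ∑ i ∈ Finset.range m, D i x with hX
  set S : ℕ → Ω → ℝ := fun m x => ∑ i ∈ Finset.range m, D i x ^ 2 with hS
  have hXb : ∀ m, BddMeasurable (X m) := fun m => BddMeasurable.sum fun i _ => hD i
  have hSb : ∀ m, BddMeasurable (S m) := fun m => BddMeasurable.sum fun i _ => (hD i).pow 2
  have hS0 : ∀ m x, 0 ≤ S m x := fun m x => Finset.sum_nonneg fun i _ => sq_nonneg _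
  -- A supermartingale in disguise: averaging `Φ (m + 1)` over `θ m`, which negates only the last
  -- difference, gives at most `Φ m`. The increment of the even power is paid for by the increment
  -- of `S`.
  set Φ : ℕ → Ω → ℝ := fun m x => X m x ^ (2 * (k + 1)) + (-C) * (X m x ^ (2 * k) * S m x)
    with hΦ
  have hΦb : ∀ m, BddMeasurable (Φ m) := fun m =>
    ((hXb m).pow _).add ((BddMeasurable.const _).mul (((hXb m).pow _).mul (hSb m)))
  have hstep : ∀ m, ∫ x, Φ m x ∂μ ≤ 0 := by
    intro m
    induction m with
    | zero => simp [hΦ, hX, hS]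
    | succ m ih =>
      have h1 : ∫ x, Φ (m + 1) (θ m x) ∂μ = ∫ x, Φ (m + 1) x ∂μ := by
        have h2 := integral_map (μ := μ) (φ := θ m) (hθ m).measurable.aemeasurable
          (f := Φ (m + 1)) (hΦb (m + 1)).aesm
        rw [(hθ m).map_eq] at h2
        exact h2.symm
      have hΦθ : BddMeasurable fun x => Φ (m + 1) (θ m x) := (hΦb _).comp (hθ m).measurable
      have h2 : ∫ x, Φ (m + 1) x + Φ (m + 1) (θ m x) ∂μ ≤ ∫ x, 2 * Φ m x ∂μ := by
        refine integral_mono ((hΦb _).add hΦθ).integrable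
          ((BddMeasurable.const 2).mul (hΦb m)).integrable fun x => ?_
        have e1 : X (m + 1) x = X m x + D m x := Finset.sum_range_succ _ _
        have e2 : S (m + 1) x = S m x + D m x ^ 2 := Finset.sum_range_succ _ _
        have e3 : X (m + 1) (θ m x) = X m x - D m x := by
          simp only [hX, Finset.sum_range_succ, hodd, ← sub_eq_add_neg]
          congr 1
          exact Finset.sum_congr rfl fun i hi => hinv i m x (Finset.mem_range.1 hi)
        have e4 : S (m + 1) (θ m x) = S m x + D m x ^ 2 := by
          simp only [hS, Finset.sum_range_succ, hodd, neg_sq]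
          congr 1
          exact Finset.sum_congr rfl fun i hi => by rw [hinv i m x (Finset.mem_range.1 hi)]
        simp only [hΦ, e1, e2, e3, e4]
        have h3 := even_pow_increment_le (X m x) (D m x) k
        have h4 : X m x ^ (2 * k) ≤
            ((X m x + D m x) ^ (2 * k) + (X m x - D m x) ^ (2 * k)) / 2 := by
          obtain ⟨-, hconv⟩ := (even_two_mul k).convexOn_pow (𝕜 := ℝ)
          have := hconv (Set.mem_univ (X m x + D m x)) (Set.mem_univ (X m x - D m x))
            (a := 1 / 2) (b := 1 / 2) (by norm_num) (by norm_num) (by norm_num)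
          simp only [smul_eq_mul] at this
          rw [show 1 / 2 * (X m x + D m x) + 1 / 2 * (X m x - D m x) = X m x by ring] at this
          linarith
        have h5 := mul_le_mul_of_nonneg_left h4 (mul_nonneg hC0 (hS0 m x))
        rw [← hC] at h3
        linarith
      rw [integral_add (hΦb _).integrable hΦθ.integrable, h1, integral_const_mul] at h2
      linarith
  have hM := hstep M
  have hXM := hXb M
  have i1 : Integrable (fun x => X M x ^ (2 * (k + 1))) μ := (hXM.pow _).integrable
  have i2 : Integrable (fun x => X M x ^ (2 * k) * S M x) μ := ((hXM.pow _).mul (hSb M)).integrable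
  have i3 : Integrable (fun x => W x ^ (k + 1)) μ := (hW.pow _).integrable
  rw [show Φ M = fun x => X M x ^ (2 * (k + 1)) + (-C) * (X M x ^ (2 * k) * S M x) from rfl,
    integral_add i1 (i2.const_mul _), integral_const_mul] at hM
  -- Young's inequality splits the product so that `k` of the `k + 1` copies of the left-hand
  -- integral can be absorbed.
  have h6 : ((k : ℝ) + 1) * C * ∫ x, X M x ^ (2 * k) * S M x ∂μ ≤
      k * ∫ x, X M x ^ (2 * (k + 1)) ∂μ + C ^ (k + 1) * ∫ x, W x ^ (k + 1) ∂μ := by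
    rw [← integral_const_mul, ← integral_const_mul, ← integral_const_mul,
      ← integral_add (i1.const_mul _) (i3.const_mul _)]
    refine integral_mono (i2.const_mul _) ((i1.const_mul _).add (i3.const_mul _)) fun x => ?_
    have hW0 : 0 ≤ W x := (hS0 M x).trans (hDW x)
    have h7 := young_pow (sq_nonneg (X M x)) (mul_nonneg hC0 hW0) k
    simp only [← pow_mul, mul_pow C] at h7
    have h8 : X M x ^ (2 * k) * S M x ≤ X M x ^ (2 * k) * W x :=
      mul_le_mul_of_nonneg_left (hDW x) ((even_two_mul k).pow_nonneg _)
    have h9 := mul_le_mul_of_nonneg_left h8 (show 0 ≤ ((k : ℝ) + 1) * C by positivity)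
    simp only
    linarith
  have h10 : ((k : ℝ) + 1) * ∫ x, X M x ^ (2 * (k + 1)) ∂μ ≤
      ((k : ℝ) + 1) * (C * ∫ x, X M x ^ (2 * k) * S M x ∂μ) := by
    gcongr; linarith
  linarith

/-- The norm form of the preceding inequality. The constant `2k²` is not sharp in `k`, but
polynomial growth suffices. -/
theorem eLpNorm_sq_le_square_function [IsFiniteMeasure μ] {D : ℕ → Ω → ℝ}
    {θ : ℕ → Ω → Ω} {W : Ω → ℝ} (hθ : ∀ m, MeasurePreserving (θ m) μ μ)
    (hD : ∀ m, BddMeasurable (D m)) (hodd : ∀ m x, D m (θ m x) = -D m x)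
    (hinv : ∀ i m x, i < m → D i (θ m x) = D i x) (hW : BddMeasurable W) (M : ℕ)
    (hDW : ∀ x, ∑ m ∈ Finset.range M, D m x ^ 2 ≤ W x) {k : ℕ} (hk : k ≠ 0) :
    eLpNorm (fun x => ∑ m ∈ Finset.range M, D m x) ((2 * k : ℕ) : ℝ≥0∞) μ ^ 2 ≤
      ENNReal.ofReal (2 * (k : ℝ) ^ 2) * eLpNorm W (k : ℝ≥0∞) μ := by
  obtain ⟨k, rfl⟩ := Nat.exists_eq_succ_of_ne_zero hk
  have hW0 : ∀ x, 0 ≤ W x := fun x => (Finset.sum_nonneg fun i _ => sq_nonneg _).trans (hDW x)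
  refine (ENNReal.pow_le_pow_left_iff (n := k + 1) (by omega)).1 ?_
  rw [← pow_mul, mul_pow, eLpNorm_natCast_pow_eq_integral (BddMeasurable.sum fun i _ => hD i)
    (by omega) (fun x => (even_two_mul _).pow_abs _), eLpNorm_natCast_pow_eq_integral hW
    (by omega) (fun x => by rw [abs_of_nonneg (hW0 x)]), ← ENNReal.ofReal_pow (by positivity),
    ← ENNReal.ofReal_mul (by positivity)]
  refine ENNReal.ofReal_le_ofReal ?_
  have := integral_even_pow_le_square_function hθ hD hodd hinv hW M hDW k
  push_cast
  exact this

/-- Hölder's inequality for a finite product, with a common large exponent. -/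
theorem eLpNorm_prod_le_prod [IsProbabilityMeasure μ] {ι : Type*} {s : Finset ι}
    {g : ι → Ω → ℝ} (hg : ∀ i ∈ s, AEStronglyMeasurable (g i) μ) {p P : ℝ≥0∞}
    (hP0 : P ≠ 0) (hp : s.card * p ≤ P) :
    eLpNorm (fun x => ∏ i ∈ s, g i x) p μ ≤ ∏ i ∈ s, eLpNorm (g i) P μ := by
  classical
  have hm : ∀ t ⊆ s, AEStronglyMeasurable (fun x => ∏ i ∈ t, g i x) μ := fun t ht =>
    Finset.aestronglyMeasurable_fun_prod t fun i hi => hg i (ht hi)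
  -- The exponent `P / t.card` drops as factors are added; for the empty product it is `P / 0 = ∞`.
  have key : ∀ t ⊆ s, eLpNorm (fun x => ∏ i ∈ t, g i x) (P / t.card) μ ≤
      ∏ i ∈ t, eLpNorm (g i) P μ := by
    intro t
    induction t using Finset.induction_on with
    | empty =>
      intro _
      have h0 : P / (0 : ℝ≥0∞) ≠ 0 := by simp [hP0, ENNReal.div_zero]
      simp [eLpNorm_const (1 : ℝ) h0 (IsProbabilityMeasure.ne_zero μ)]
    | insert i t hi ih =>
      intro hs
      have hts : t ⊆ s := (Finset.subset_insert _ _).trans hs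
      simp only [Finset.prod_insert hi]
      have : ENNReal.HolderTriple P (P / t.card) (P / (insert i t).card) := ⟨by
        rw [ENNReal.inv_div (Or.inl (by simp)) (Or.inr hP0),
          ENNReal.inv_div (Or.inl (by simp)) (Or.inr hP0), Finset.card_insert_of_notMem hi]
        simp only [ENNReal.div_eq_inv_mul]
        push_cast
        ring⟩
      refine le_trans ?_ (mul_le_mul_right (ih hts) _)
      exact eLpNorm_smul_le_mul_eLpNorm (𝕜 := ℝ) (hm t hts)
        (hg i (hs (Finset.mem_insert_self _ _)))
  refine (eLpNorm_le_eLpNorm_of_exponent_le ?_ (hm s subset_rfl)).trans (key s subset_rfl)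
  rw [ENNReal.le_div_iff_mul_le (Or.inr hP0) (Or.inl (by simp)), mul_comm]
  exact hp

end Analysis

/-! ### Peeling off free coordinates by a type 2 argument. -/

section Peeling

variable {Ω : Type*} [MeasurableSpace Ω] {μ : Measure Ω} {d : ℕ}
  {f : (Fin d → ℕ) → Ω → ℝ} {θ : Fin d → ℕ → Ω → Ω}

/-- A family of bounded functions indexed by vectors together with measure preserving maps
`θ i m`, the map `θ i m` changing the sign of the functions of index `r` with `r i = m` and
leaving those with `r i < m` unchanged. -/
structure HaarSystem (μ : Measure Ω) (f : (Fin d → ℕ) → Ω → ℝ) (θ : Fin d → ℕ → Ω → Ω) :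
    Prop where
  measurable : ∀ r, Measurable (f r)
  abs_le_one : ∀ r x, |f r x| ≤ 1
  preserving : ∀ i m, MeasurePreserving (θ i m) μ μ
  invariant : ∀ r i m x, r i < m → f r (θ i m x) = f r x
  odd : ∀ r i x, f r (θ i (r i) x) = -f r x

theorem HaarSystem.bddMeasurable (H : HaarSystem μ f θ) (r : Fin d → ℕ) : BddMeasurable (f r) :=
  ⟨H.measurable r, 1, H.abs_le_one r⟩

/-- A vector valued sum of the functions of a family. -/
noncomputable def vecSum {E : Type*} [AddCommGroup E] [Module ℝ E]
    (f : (Fin d → ℕ) → Ω → ℝ) (c : (Fin d → ℕ) → E) (S : Finset (Fin d → ℕ)) (x : Ω) : E :=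
  ∑ r ∈ S, f r x • c r

/-- A nonnegative function on a vector space which behaves like the square of a norm of type 2,
at the exponent `K` and with constant `γ`. -/
structure IsSmooth {E : Type*} [AddCommGroup E] (U : E → ℝ) (K : ℕ) (γ : ℝ) : Prop where
  nonneg : ∀ A, 0 ≤ U A
  zero : U 0 = 0
  const_nonneg : 0 ≤ γ
  exponent_ne_zero : K ≠ 0
  add_sub : ∀ A B, U (A + B) ^ K + U (A - B) ^ K ≤ 2 * (U A + γ * U B) ^ K

variable {E : Type*} [AddCommGroup E] [Module ℝ E] {U : E → ℝ} {K : ℕ} {γ : ℝ}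
  {c : (Fin d → ℕ) → E}

/-- The slices `r i = m` are added in increasing order of `m`. The flip `θ i m` fixes what has been
collected and negates the new slice, so the smoothness inequality holds on average. As `U` plays the
role of a squared norm, the triangle inequality for `U` adds squares, which makes a free coordinate
cost a square root in the norm. -/
theorem eLpNorm_vecSum_le_sum (H : HaarSystem μ f θ) (hU : IsSmooth U K γ)
    (hm : ∀ S, Measurable fun x => U (vecSum f c S x)) (S : Finset (Fin d → ℕ)) (i : Fin d)
    {n : ℕ} (hS : ∀ r ∈ S, r i ≤ n) :
    eLpNorm (fun x => U (vecSum f c S x)) (K : ℝ≥0∞) μ ≤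
      ∑ m ∈ Finset.range (n + 1), ENNReal.ofReal γ *
        eLpNorm (fun x => U (vecSum f c (S.filter fun r => r i = m) x)) (K : ℝ≥0∞) μ := by
  have key : ∀ m, eLpNorm (fun x => U (vecSum f c (S.filter fun r => r i < m) x)) (K : ℝ≥0∞) μ ≤
      ∑ m ∈ Finset.range m, ENNReal.ofReal γ *
        eLpNorm (fun x => U (vecSum f c (S.filter fun r => r i = m) x)) (K : ℝ≥0∞) μ := by
    intro m
    induction m with
    | zero => simp [vecSum, hU.zero]
    | succ m ih =>
      have hsplit : ∀ x, vecSum f c (S.filter fun r => r i < m + 1) x =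
          vecSum f c (S.filter fun r => r i < m) x + vecSum f c (S.filter fun r => r i = m) x := by
        intro x
        rw [vecSum, vecSum, vecSum, ← Finset.sum_union]
        · congr 1
          ext r
          simp only [Finset.mem_filter, Finset.mem_union, Nat.lt_succ_iff_lt_or_eq]
          tauto
        · refine Finset.disjoint_filter.2 fun r _ h1 h2 => by omega
      have hlt : ∀ x, vecSum f c (S.filter fun r => r i < m) (θ i m x) =
          vecSum f c (S.filter fun r => r i < m) x := fun x =>
        Finset.sum_congr rfl fun r hr => by
          rw [H.invariant r i m x (Finset.mem_filter.1 hr).2]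
      have heq : ∀ x, vecSum f c (S.filter fun r => r i = m) (θ i m x) =
          -vecSum f c (S.filter fun r => r i = m) x := fun x => by
        rw [vecSum, vecSum, ← Finset.sum_neg_distrib]
        refine Finset.sum_congr rfl fun r hr => ?_
        have h1 := H.odd r i x
        rw [(Finset.mem_filter.1 hr).2] at h1
        rw [h1, neg_smul]
      rw [Finset.sum_range_succ]
      refine le_trans ?_ (add_le_add_left ih _)
      have h1 : eLpNorm (fun x => γ * U (vecSum f c (S.filter fun r => r i = m) x)) (K : ℝ≥0∞) μ =
          ENNReal.ofReal γ *
            eLpNorm (fun x => U (vecSum f c (S.filter fun r => r i = m) x)) (K : ℝ≥0∞) μ := by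
        have := eLpNorm_const_smul γ (fun x => U (vecSum f c (S.filter fun r => r i = m) x))
          (K : ℝ≥0∞) μ
        rw [Real.enorm_eq_ofReal hU.const_nonneg] at this
        exact this
      rw [← h1]
      refine le_trans ?_ (eLpNorm_add_le (hm _).aestronglyMeasurable
        ((hm _).const_mul γ).aestronglyMeasurable
        (by exact_mod_cast Nat.one_le_iff_ne_zero.2 hU.exponent_ne_zero))
      refine eLpNorm_le_of_average_le (H.preserving i m) (hm _) (fun x => hU.nonneg _)
        (fun x => ?_) hU.exponent_ne_zero fun x => ?_
      · exact add_nonneg (hU.nonneg _) (mul_nonneg hU.const_nonneg (hU.nonneg _))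
      · rw [hsplit, hsplit, hlt, heq, ← sub_eq_add_neg]
        exact hU.add_sub _ _
  have h := key (n + 1)
  rwa [Finset.filter_true_of_mem fun r hr => Nat.lt_succ_of_le (hS r hr)] at h

/-- Peeling off the coordinates in `L` one after the other. -/
theorem eLpNorm_vecSum_le [IsProbabilityMeasure μ] (H : HaarSystem μ f θ) (hU : IsSmooth U K γ)
    (hm : ∀ S, Measurable fun x => U (vecSum f c S x)) {n : ℕ} {M : ℝ} (L : Finset (Fin d)) :
    ∀ S : Finset (Fin d → ℕ), (∀ r ∈ S, ∀ i, r i ≤ n) →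
      (∀ S' ⊆ S, (∀ r ∈ S', ∀ s ∈ S', ∀ i ∈ L, r i = s i) → ∀ x, U (vecSum f c S' x) ≤ M) →
      eLpNorm (fun x => U (vecSum f c S x)) (K : ℝ≥0∞) μ ≤
        ENNReal.ofReal ((γ * (n + 1)) ^ L.card * M) := by
  classical
  induction L using Finset.induction_on with
  | empty =>
    intro S _ hM
    have h1 := hM S subset_rfl (by simp)
    refine (eLpNorm_le_of_ae_bound (C := M) (Filter.Eventually.of_forall fun x => ?_)).trans ?_
    · rw [Real.norm_of_nonneg (hU.nonneg _)]; exact h1 x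
    · simp
  | insert i L hi ih =>
    intro S hS hM
    refine (eLpNorm_vecSum_le_sum H hU hm S i fun r hr => hS r hr i).trans ?_
    have h1 : ∀ m ∈ Finset.range (n + 1), ENNReal.ofReal γ *
        eLpNorm (fun x => U (vecSum f c (S.filter fun r => r i = m) x)) (K : ℝ≥0∞) μ ≤
        ENNReal.ofReal γ * ENNReal.ofReal ((γ * (n + 1)) ^ L.card * M) := by
      intro m _
      gcongr
      refine ih _ (fun r hr => hS r (Finset.mem_filter.1 hr).1) fun S' hS' hL x => ?_
      refine hM S' (hS'.trans (Finset.filter_subset _ _)) (fun r hr s hs j hj => ?_) x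
      rcases Finset.mem_insert.1 hj with rfl | hj
      · rw [(Finset.mem_filter.1 (hS' hr)).2, (Finset.mem_filter.1 (hS' hs)).2]
      · exact hL r hr s hs j hj
    refine (Finset.sum_le_sum h1).trans (le_of_eq ?_)
    rw [Finset.sum_const, Finset.card_range, nsmul_eq_mul, ← ENNReal.ofReal_mul hU.const_nonneg,
      ← ENNReal.ofReal_natCast, ← ENNReal.ofReal_mul (by positivity),
      Finset.card_insert_of_notMem hi]
    congr 1
    push_cast
    ring

/-- The exponent `2k` on the square is chosen to give the same constant as for `boxSq`. -/
theorem isSmooth_sq {k : ℕ} (hk : k ≠ 0) :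
    IsSmooth (fun x : ℝ => x ^ 2) (2 * k) (8 * (k : ℝ) + 1) where
  nonneg x := sq_nonneg x
  zero := by norm_num
  const_nonneg := by positivity
  exponent_ne_zero := by omega
  add_sub x y := by
    rw [← pow_mul, ← pow_mul]
    exact add_pow_add_sub_pow_le (2 * k) (by push_cast; linarith)

theorem isSmooth_boxSq {α β : Type*} [Fintype α] [Fintype β] {k : ℕ} (hk : k ≠ 0) :
    IsSmooth (boxSq : (α → β → ℝ) → ℝ) (2 * k) (8 * (k : ℝ) + 1) where
  nonneg := boxSq_nonneg
  zero := boxSq_zero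
  const_nonneg := by positivity
  exponent_ne_zero := by omega
  add_sub A B := boxSq_smooth A B k le_rfl

/-- The sum of the functions of a family over a set of indices. -/
noncomputable def famSum (f : (Fin d → ℕ) → Ω → ℝ) (S : Finset (Fin d → ℕ)) (x : Ω) : ℝ :=
  ∑ r ∈ S, f r x

theorem HaarSystem.bddMeasurable_famSum (H : HaarSystem μ f θ) (S : Finset (Fin d → ℕ)) :
    BddMeasurable (famSum f S) :=
  BddMeasurable.sum fun r _ => H.bddMeasurable r

theorem HaarSystem.abs_famSum_le_one (H : HaarSystem μ f θ) {S : Finset (Fin d → ℕ)}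
    (hS : ∀ r ∈ S, ∀ s ∈ S, r = s) (x : Ω) : |famSum f S x| ≤ 1 := by
  have hcard : S.card ≤ 1 := Finset.card_le_one.2 hS
  rw [famSum]
  refine (Finset.abs_sum_le_sum_abs _ _).trans ((Finset.sum_le_card_nsmul S _ 1
    fun r _ => H.abs_le_one r x).trans ?_)
  rw [nsmul_eq_mul, mul_one]
  exact_mod_cast hcard

/-- A sum with `L` free coordinates. -/
theorem eLpNorm_famSum_sq_le [IsProbabilityMeasure μ] (H : HaarSystem μ f θ)
    {k n : ℕ} (hk : k ≠ 0) {S : Finset (Fin d → ℕ)} (hS : ∀ r ∈ S, ∀ i, r i ≤ n)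
    (L : Finset (Fin d)) (hL : ∀ r ∈ S, ∀ s ∈ S, (∀ i ∈ L, r i = s i) → r = s) :
    eLpNorm (fun x => famSum f S x ^ 2) ((2 * k : ℕ) : ℝ≥0∞) μ ≤
      ENNReal.ofReal (((8 * (k : ℝ) + 1) * (n + 1)) ^ L.card) := by
  have h := eLpNorm_vecSum_le (M := 1) (c := fun _ => (1 : ℝ)) H (isSmooth_sq hk)
    (fun S => ?_) (n := n) L S hS fun S' hS' h' x => ?_
  · simpa only [vecSum, famSum, smul_eq_mul, mul_one] using h
  · simpa only [vecSum, famSum, smul_eq_mul, mul_one] using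
      ((H.bddMeasurable_famSum S).pow 2).measurable
  · have h1 := H.abs_famSum_le_one
      (fun r hr s hs => hL r (hS' hr) s (hS' hs) fun i hi => h' r hr s hs i hi) x
    simp only [vecSum, smul_eq_mul, mul_one]
    exact (sq_le_one_iff_abs_le_one _).2 h1

theorem eLpNorm_sq_eq (g : Ω → ℝ) (k : ℕ) :
    eLpNorm (fun x => g x ^ 2) ((2 * k : ℕ) : ℝ≥0∞) μ = eLpNorm g ((4 * k : ℕ) : ℝ≥0∞) μ ^ 2 := by
  have h := eLpNorm_norm_rpow (p := ((2 * k : ℕ) : ℝ≥0∞)) (μ := μ) g (q := 2) (by norm_num)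
  have e : ((2 * k : ℕ) : ℝ≥0∞) * ENNReal.ofReal 2 = ((4 * k : ℕ) : ℝ≥0∞) := by
    rw [show (2 : ℝ) = ((2 : ℕ) : ℝ) by norm_num, ENNReal.ofReal_natCast, ← Nat.cast_mul]
    congr 1; ring
  rw [e] at h
  simpa using h

end Peeling

/-! ### Families as matrices in two coordinates, and the gain for a pair of vertices. -/

section Sums

variable {Ω : Type*} {d : ℕ} {f : (Fin d → ℕ) → Ω → ℝ}

theorem exists_mem_of_famSum_ne_zero {S : Finset (Fin d → ℕ)} {x : Ω} (h : famSum f S x ≠ 0) :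
    ∃ r, r ∈ S := by
  by_contra hne
  push Not at hne
  exact h (by rw [famSum, Finset.eq_empty_of_forall_notMem hne, Finset.sum_empty])

/-- The matrix unit at the position given by two coordinates of a vector. -/
noncomputable def matrixUnit (j i : Fin d) (n : ℕ) (r : Fin d → ℕ) :
    Fin (n + 1) → Fin (n + 1) → ℝ :=
  fun a s => if r j = a ∧ r i = s then 1 else 0

theorem vecSum_matrixUnit (j i : Fin d) (n : ℕ) (S : Finset (Fin d → ℕ)) (x : Ω)
    (a s : Fin (n + 1)) : vecSum f (matrixUnit j i n) S x a s =
      famSum f (S.filter fun r => r j = a ∧ r i = s) x := by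
  rw [vecSum, Finset.sum_apply, Finset.sum_apply, famSum, Finset.sum_filter]
  refine Finset.sum_congr rfl fun r _ => ?_
  simp only [matrixUnit, Pi.smul_apply, smul_eq_mul, mul_ite, mul_one, mul_zero]

end Sums

section Pair

variable {Ω : Type*} [MeasurableSpace Ω] {μ : Measure Ω} {d : ℕ}
  {f : (Fin d → ℕ) → Ω → ℝ} {θ : Fin d → ℕ → Ω → Ω}

theorem HaarSystem.famSum_invariant (H : HaarSystem μ f θ) {S : Finset (Fin d → ℕ)} {i : Fin d}
    {m : ℕ} (hS : ∀ r ∈ S, r i < m) (x : Ω) : famSum f S (θ i m x) = famSum f S x :=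
  Finset.sum_congr rfl fun r hr => H.invariant r i m x (hS r hr)

theorem HaarSystem.famSum_odd (H : HaarSystem μ f θ) {S : Finset (Fin d → ℕ)} {i : Fin d}
    {m : ℕ} (hS : ∀ r ∈ S, r i = m) (x : Ω) : famSum f S (θ i m x) = -famSum f S x := by
  rw [famSum, famSum, ← Finset.sum_neg_distrib]
  refine Finset.sum_congr rfl fun r hr => ?_
  have h := H.odd r i x
  rwa [hS r hr] at h

theorem HaarSystem.bddMeasurable_boxSq (H : HaarSystem μ f θ) (j i : Fin d) (n : ℕ)
    (S : Finset (Fin d → ℕ)) :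
    BddMeasurable fun x => boxSq (vecSum f (matrixUnit j i n) S x) := by
  simp only [boxSq, vecSum_matrixUnit]
  exact (BddMeasurable.sum fun a _ => BddMeasurable.sum fun a' _ => (BddMeasurable.sum fun s _ =>
    (H.bddMeasurable_famSum _).mul (H.bddMeasurable_famSum _)).pow 2).sqrt

/-- If all coordinates but `j` and `i` are fixed, the matrix of the family has at most one entry
in each row, and different rows have disjoint supports. -/
theorem HaarSystem.boxSq_le (H : HaarSystem μ f θ) {j i : Fin d} {n : ℕ}
    {S : Finset (Fin d → ℕ)} (hdet : ∀ r ∈ S, ∀ s ∈ S, r j = s j → r = s)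
    (hsum : ∀ r ∈ S, ∀ s ∈ S, r j + r i = s j + s i) (x : Ω) :
    boxSq (vecSum f (matrixUnit j i n) S x) ≤ Real.sqrt (n + 1) := by
  refine Real.sqrt_le_sqrt ?_
  simp only [vecSum_matrixUnit]
  -- `A Aᵀ` is diagonal with entries in `[0, 1]`. Its Hilbert–Schmidt norm is thus at most `√(n +
  -- 1)`, whereas its trace could be `n + 1`: this is the source of the gain.
  have hle : ∀ a a' : Fin (n + 1),
      (∑ s : Fin (n + 1), famSum f (S.filter fun r => r j = a ∧ r i = s) x *
        famSum f (S.filter fun r => r j = a' ∧ r i = s) x) ^ 2 ≤ if a = a' then 1 else 0 := by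
    intro a a'
    split_ifs with haa
    · subst haa
      refine pow_le_one₀ (Finset.sum_nonneg fun s _ => mul_self_nonneg _) ?_
      by_cases h0 : ∃ s : Fin (n + 1), famSum f (S.filter fun r => r j = a ∧ r i = s) x ≠ 0
      · obtain ⟨s, hs⟩ := h0
        obtain ⟨r, hr⟩ := exists_mem_of_famSum_ne_zero hs
        rw [Finset.mem_filter] at hr
        rw [Finset.sum_eq_single s]
        · have h1 : |famSum f (S.filter fun r => r j = a ∧ r i = s) x| ≤ 1 := by
            refine H.abs_famSum_le_one (fun r hr s hs => ?_) x
            rw [Finset.mem_filter] at hr hs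
            exact hdet r hr.1 s hs.1 (hr.2.1.trans hs.2.1.symm)
          rw [← sq]
          exact (sq_le_one_iff_abs_le_one _).2 h1
        · intro s' _ hs'
          by_contra hne
          obtain ⟨r', hr'⟩ := exists_mem_of_famSum_ne_zero (left_ne_zero_of_mul hne)
          rw [Finset.mem_filter] at hr'
          have := hdet r hr.1 r' hr'.1 (hr.2.1.trans hr'.2.1.symm)
          subst this
          exact hs' (Fin.ext (hr'.2.2.symm.trans hr.2.2))
        · simp
      · push Not at h0
        simp [h0]
    · rw [Finset.sum_eq_zero, zero_pow two_ne_zero]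
      intro s _
      by_contra hne
      obtain ⟨r, hr⟩ := exists_mem_of_famSum_ne_zero (left_ne_zero_of_mul hne)
      obtain ⟨r', hr'⟩ := exists_mem_of_famSum_ne_zero (right_ne_zero_of_mul hne)
      rw [Finset.mem_filter] at hr hr'
      have := hsum r hr.1 r' hr'.1
      rw [hr.2.1, hr.2.2, hr'.2.1, hr'.2.2] at this
      exact haa (Fin.ext (by omega))
  refine (Finset.sum_le_sum fun a _ => Finset.sum_le_sum fun a' _ => hle a a').trans ?_
  simp

/-- The gain for a single coincidence: two vectors with the same coordinate `j`, whose coordinates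
`i` are separated. -/
theorem eLpNorm_pair_sq_le [IsProbabilityMeasure μ] (H : HaarSystem μ f θ)
    {k n : ℕ} (hk : k ≠ 0) {j i : Fin d} {C C' : Finset (Fin d → ℕ)}
    (hC : ∀ r ∈ C, ∀ l, r l ≤ n) (hC' : ∀ r ∈ C', ∀ l, r l ≤ n)
    (hsep : ∀ r ∈ C, ∀ s ∈ C', r i < s i) {L L' : Finset (Fin d)}
    (hdet : ∀ r ∈ C, ∀ s ∈ C, (∀ l ∈ L, r l = s l) → r j = s j → r = s)
    (hdet' : ∀ r ∈ C', ∀ s ∈ C', (∀ l ∈ L', r l = s l) → r j = s j → r = s)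
    (hsum : ∀ r ∈ C', ∀ s ∈ C', (∀ l ∈ L', r l = s l) → r j + r i = s j + s i) :
    eLpNorm (fun x => ∑ a : Fin (n + 1), famSum f (C.filter fun r => r j = a) x *
        famSum f (C'.filter fun r => r j = a) x) ((2 * k : ℕ) : ℝ≥0∞) μ ^ 2 ≤
      ENNReal.ofReal (((8 * (k : ℝ) + 1) * (n + 1)) ^ (L.card + 1) *
        ((8 * (k : ℝ) + 1) * (n + 1)) ^ (L'.card + 1) / Real.sqrt (n + 1)) := by
  set T : ℝ := (8 * (k : ℝ) + 1) * (n + 1) with hT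
  have hT0 : 0 ≤ T := by positivity
  set F : Fin (n + 1) → Ω → ℝ := fun a => famSum f (C.filter fun r => r j = a) with hF
  set A : Fin (n + 1) → ℕ → Ω → ℝ := fun a m =>
    famSum f (C'.filter fun r => r j = a ∧ r i = m) with hA
  -- The product is sorted by the coordinate `i` of the second vector, the larger of the two, so
  -- that `D m` is odd under `θ i m`.
  set D : ℕ → Ω → ℝ := fun m x => ∑ a, F a x * A a m x with hD
  set W : Ω → ℝ := fun x => (∑ a, F a x ^ 2) * boxSq (vecSum f (matrixUnit j i n) C' x) with hW
  have hFb : ∀ a, BddMeasurable (F a) := fun a => H.bddMeasurable_famSum _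
  have hDb : ∀ m, BddMeasurable (D m) := fun m =>
    BddMeasurable.sum fun a _ => (hFb a).mul (H.bddMeasurable_famSum _)
  have hF2b : BddMeasurable fun x => ∑ a, F a x ^ 2 := BddMeasurable.sum fun a _ => (hFb a).pow 2
  have hBb := H.bddMeasurable_boxSq j i n C'
  have hWb : BddMeasurable W := hF2b.mul hBb
  have hodd : ∀ m x, D m (θ i m x) = -D m x := by
    intro m x
    simp only [hD]
    rw [← Finset.sum_neg_distrib]
    refine Finset.sum_congr rfl fun a _ => ?_
    have h1 : A a m (θ i m x) = -A a m x :=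
      H.famSum_odd (fun r hr => (Finset.mem_filter.1 hr).2.2) x
    rw [h1]
    -- If `A a m x` vanishes, `F a` is irrelevant. Otherwise some vector of `C'` has coordinate `i`
    -- equal to `m`, and separation makes `F a` invariant under the flip.
    by_cases h0 : A a m x = 0
    · simp [h0]
    · obtain ⟨s, hs⟩ := exists_mem_of_famSum_ne_zero h0
      rw [Finset.mem_filter] at hs
      have h2 : F a (θ i m x) = F a x := H.famSum_invariant (fun r hr =>
        hs.2.2 ▸ hsep r (Finset.mem_filter.1 hr).1 s hs.1) x
      rw [h2, mul_neg]
  have hinv : ∀ l m x, l < m → D l (θ i m x) = D l x := by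
    intro l m x hlm
    refine Finset.sum_congr rfl fun a _ => ?_
    have h1 : A a l (θ i m x) = A a l x :=
      H.famSum_invariant (fun r hr => (Finset.mem_filter.1 hr).2.2.trans_lt hlm) x
    rw [h1]
    by_cases h0 : A a l x = 0
    · simp [h0]
    · obtain ⟨s, hs⟩ := exists_mem_of_famSum_ne_zero h0
      rw [Finset.mem_filter] at hs
      have h2 : F a (θ i m x) = F a x := H.famSum_invariant (fun r hr =>
        (hsep r (Finset.mem_filter.1 hr).1 s hs.1).trans (hs.2.2.trans_lt hlm)) x
      rw [h2]
  have hDW : ∀ x, ∑ m ∈ Finset.range (n + 1), D m x ^ 2 ≤ W x := by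
    intro x
    rw [Finset.sum_range]
    refine le_trans (le_of_eq ?_) (sum_sq_apply_le (fun a => F a x) _)
    refine Finset.sum_congr rfl fun s _ => ?_
    simp only [hD, hA, vecSum_matrixUnit]
  have hX : ∀ x, ∑ a : Fin (n + 1), F a x * famSum f (C'.filter fun r => r j = a) x =
      ∑ m ∈ Finset.range (n + 1), D m x := by
    intro x
    simp only [hD]
    rw [Finset.sum_comm]
    refine Finset.sum_congr rfl fun a _ => ?_
    rw [← Finset.mul_sum]
    congr 1
    simp only [hA, famSum, ← Finset.filter_filter]
    refine (Finset.sum_fiberwise_of_maps_to (fun r hr => ?_) _).symm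
    rw [Finset.mem_range, Nat.lt_succ_iff]
    exact hC' r (Finset.mem_filter.1 hr).1 i
  have hX' := funext hX
  rw [hX']
  refine (eLpNorm_sq_le_square_function (H.preserving i) hDb hodd hinv hWb _ hDW hk).trans ?_
  have hF2 : eLpNorm (fun x => ∑ a, F a x ^ 2) ((2 * k : ℕ) : ℝ≥0∞) μ ≤
      ENNReal.ofReal ((n + 1) * T ^ L.card) := by
    have h1 := eLpNorm_sum_le (μ := μ) (p := ((2 * k : ℕ) : ℝ≥0∞)) (s := Finset.univ)
      (f := fun a x => F a x ^ 2) (fun a _ => ((hFb a).pow 2).aesm)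
      (by exact_mod_cast (by omega : 1 ≤ 2 * k))
    have h2 : (∑ a, fun x => F a x ^ 2) = fun x => ∑ a, F a x ^ 2 := by
      ext x; simp
    rw [h2] at h1
    refine h1.trans ((Finset.sum_le_sum fun a _ => eLpNorm_famSum_sq_le H hk
      (n := n) (fun r hr => hC r (Finset.mem_filter.1 hr).1) L fun r hr s hs hrs => ?_).trans
      (le_of_eq ?_))
    · rw [Finset.mem_filter] at hr hs
      exact hdet r hr.1 s hs.1 hrs (hr.2.trans hs.2.symm)
    · rw [Finset.sum_const, Finset.card_univ, Fintype.card_fin, nsmul_eq_mul,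
        ← ENNReal.ofReal_natCast, ← ENNReal.ofReal_mul (by positivity)]
      push_cast
      rfl
  have hB : eLpNorm (fun x => boxSq (vecSum f (matrixUnit j i n) C' x))
      ((2 * k : ℕ) : ℝ≥0∞) μ ≤ ENNReal.ofReal (T ^ L'.card * Real.sqrt (n + 1)) := by
    refine eLpNorm_vecSum_le H (isSmooth_boxSq hk) (fun S => (H.bddMeasurable_boxSq j i n S).1)
      L' C' hC' fun S' hS' h' x => H.boxSq_le ?_ ?_ x
    · exact fun r hr s hs => hdet' r (hS' hr) s (hS' hs) (h' r hr s hs)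
    · exact fun r hr s hs => hsum r (hS' hr) s (hS' hs) (h' r hr s hs)
  have hk' : (k : ℝ≥0∞) ≠ 0 := by exact_mod_cast hk
  have : ENNReal.HolderTriple ((2 * k : ℕ) : ℝ≥0∞) ((2 * k : ℕ) : ℝ≥0∞) (k : ℝ≥0∞) := ⟨by
    rw [← two_mul]
    push_cast
    rw [ENNReal.mul_inv (Or.inl (by norm_num)) (Or.inl (by norm_num)), ← mul_assoc,
      ENNReal.mul_inv_cancel (by norm_num) (by norm_num), one_mul]⟩
  have hWn : eLpNorm W (k : ℝ≥0∞) μ ≤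
      ENNReal.ofReal ((n + 1) * T ^ L.card) * ENNReal.ofReal (T ^ L'.card * Real.sqrt (n + 1)) :=
    (eLpNorm_smul_le_mul_eLpNorm (𝕜 := ℝ) hBb.aesm hF2b.aesm).trans (mul_le_mul' hF2 hB)
  refine (mul_le_mul_right hWn _).trans ?_
  rw [← ENNReal.ofReal_mul (by positivity), ← ENNReal.ofReal_mul (by positivity)]
  refine ENNReal.ofReal_le_ofReal ?_
  have hs : Real.sqrt (n + 1) * Real.sqrt (n + 1) = n + 1 := Real.mul_self_sqrt (by positivity)
  have hs0 : 0 < Real.sqrt (n + 1) := Real.sqrt_pos.2 (by positivity)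
  rw [le_div_iff₀ hs0]
  -- The two extra factors `T` absorb the square function constant and `(n + 1)²`, against an actual
  -- cost of only `(n + 1) * √(n + 1)`.
  have hk1 : 2 * (k : ℝ) ^ 2 ≤ (8 * (k : ℝ) + 1) ^ 2 := by nlinarith [sq_nonneg (k : ℝ)]
  calc 2 * (k : ℝ) ^ 2 * ((n + 1) * T ^ L.card * (T ^ L'.card * Real.sqrt (n + 1))) *
        Real.sqrt (n + 1)
      = 2 * (k : ℝ) ^ 2 * ((n + 1) * T ^ L.card * T ^ L'.card *
        (Real.sqrt (n + 1) * Real.sqrt (n + 1))) := by ring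
    _ ≤ (8 * (k : ℝ) + 1) ^ 2 * ((n + 1) * T ^ L.card * T ^ L'.card * (n + 1)) := by
        rw [hs]; gcongr
    _ = _ := by rw [hT]; ring

end Pair

/-! ### Factorization over cliques and the count of shared values. -/

section Combinatorics

variable {V : Type} [Fintype V] {d : ℕ}

open Classical in
/-- The sum over tuples with equal coordinates `j` on the fibres of a surjection factors over
the fibres. -/
theorem sum_prod_eq_prod_fiber {T : Type*} [Fintype T] {π : V → T} (hπ : π.Surjective)
    (C : V → Finset (Fin d → ℕ)) (j : Fin d) {n : ℕ} (hC : ∀ v, ∀ r ∈ C v, r j ≤ n)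
    (g : (Fin d → ℕ) → ℝ) :
    ∑ r ∈ (Fintype.piFinset C).filter (fun r => ∀ v w, π v = π w → r v j = r w j),
        ∏ v, g (r v) =
      ∏ t, ∑ a : Fin (n + 1), ∏ v ∈ Finset.univ.filter (fun v => π v = t),
        ∑ r ∈ (C v).filter (fun r => r j = (a : ℕ)), g r := by
  rw [Finset.prod_univ_sum]
  have h1 : ∀ p : T → Fin (n + 1), ∏ t, ∏ v ∈ Finset.univ.filter (fun v => π v = t),
      ∑ r ∈ (C v).filter (fun r => r j = (p t : ℕ)), g r =
      ∑ r ∈ Fintype.piFinset (fun v => (C v).filter (fun r => r j = (p (π v) : ℕ))),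
        ∏ v, g (r v) := by
    intro p
    rw [← Finset.prod_univ_sum, ← Finset.prod_fiberwise Finset.univ π]
    refine Finset.prod_congr rfl fun t _ => Finset.prod_congr rfl fun v hv => ?_
    rw [(Finset.mem_filter.1 hv).2]
  simp_rw [h1]
  have hlt : ∀ v, ∀ r ∈ C v, r j < n + 1 := fun v r hr => Nat.lt_succ_of_le (hC v r hr)
  have hinv : ∀ t, π (Function.surjInv hπ t) = t := Function.surjInv_eq hπ
  -- Tuples are grouped by the common value on each fibre, read off at a chosen representative. The
  -- reduction modulo `n + 1` in `Fin.ofNat` is harmless, as all values are at most `n`.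
  refine (Finset.sum_fiberwise_of_maps_to (t := Fintype.piFinset fun _ : T => Finset.univ)
    (g := fun r t => Fin.ofNat (n + 1) (r (Function.surjInv hπ t) j)) (fun r _ => by simp)
    _).symm.trans ?_
  refine Finset.sum_congr rfl fun p _ => Finset.sum_congr ?_ fun _ _ => rfl
  ext r
  simp only [Finset.mem_filter, Fintype.mem_piFinset, funext_iff, Fin.ext_iff, Fin.val_ofNat]
  constructor
  · rintro ⟨⟨h2, h3⟩, h4⟩ v
    refine ⟨h2 v, ?_⟩
    rw [← h4 (π v), Nat.mod_eq_of_lt (hlt _ _ (h2 _))]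
    exact h3 _ _ (hinv _).symm
  · intro h2
    refine ⟨⟨fun v => (h2 v).1, fun v w hvw => ?_⟩, fun t => ?_⟩
    · rw [(h2 v).2, (h2 w).2, hvw]
    · rw [(h2 _).2, hinv, Nat.mod_eq_of_lt (p t).2]

/-- A family of relations, one for each coordinate, which are disjoint unions of cliques. -/
structure CliqueRelations (adj : Fin d → V → V → Prop) : Prop where
  symm : ∀ i v w, adj i v w → adj i w v
  irrefl : ∀ i v, ¬adj i v v
  trans : ∀ i u v w, adj i u v → adj i v w → u ≠ w → adj i u w

variable {adj : Fin d → V → V → Prop}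

/-- The equivalence relation of lying in the same clique. -/
def CliqueRelations.setoid (h : CliqueRelations adj) (i : Fin d) : Setoid V where
  r v w := v = w ∨ adj i v w
  iseqv :=
    { refl := fun v => Or.inl rfl
      symm := by
        rintro v w (rfl | hvw)
        · exact Or.inl rfl
        · exact Or.inr (h.symm _ _ _ hvw)
      trans := by
        rintro u v w (rfl | huv) (rfl | hvw)
        · exact Or.inl rfl
        · exact Or.inr hvw
        · exact Or.inr huv
        · rcases eq_or_ne u w with rfl | huw
          · exact Or.inl rfl
          · exact Or.inr (h.trans _ _ _ _ huv hvw huw) }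

open Classical in
/-- The coordinates other than `j` in which the vertex `v` takes part in a coincidence. -/
noncomputable def sharedCoords (adj : Fin d → V → V → Prop) (j : Fin d) (v : V) :
    Finset (Fin d) :=
  Finset.univ.filter fun i => i ≠ j ∧ ∃ w, adj i v w

open Classical in
/-- The tuples in a product set satisfying the coincidences. -/
noncomputable def coincidenceTuples (adj : Fin d → V → V → Prop) (A : V → Finset (Fin d → ℕ)) :
    Finset (V → Fin d → ℕ) :=
  (Fintype.piFinset A).filter fun r => ∀ i v w, adj i v w → r v i = r w i

open Classical in
/-- The values of the shared coordinates of a tuple. -/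
noncomputable def sharedValues (adj : Fin d → V → V → Prop) (j : Fin d) (r : V → Fin d → ℕ)
    (v : V) (i : Fin d) : ℕ :=
  if i ∈ sharedCoords adj j v then r v i else 0

/-- The cliques of one color, as a quotient of the vertex set. -/
theorem CliqueRelations.exists_quotient (h : CliqueRelations adj) (j : Fin d) :
    ∃ (T : Type) (_ : Fintype T) (π : V → T), π.Surjective ∧
      ∀ v w, π v = π w ↔ v = w ∨ adj j v w :=
  ⟨Quotient (h.setoid j), Fintype.ofFinite _, Quotient.mk _, Quotient.mk_surjective,
    fun _ _ => Quotient.eq⟩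

open Classical in
/-- The tuples with given shared coordinates form a product set, up to the coincidences in the
coordinate `j`. -/
theorem filter_sharedValues_eq {T : Type} {π : V → T} (A : V → Finset (Fin d → ℕ)) {j : Fin d}
    (h : CliqueRelations adj) (hker : ∀ v w, π v = π w ↔ v = w ∨ adj j v w)
    {b : V → Fin d → ℕ} (hb : b ∈ (coincidenceTuples adj A).image (sharedValues adj j)) :
    (coincidenceTuples adj A).filter (fun r => sharedValues adj j r = b) =
      (Fintype.piFinset fun v => (A v).filter fun r => ∀ i ∈ sharedCoords adj j v,
        r i = b v i).filter fun r => ∀ v w, π v = π w → r v j = r w j := by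
  -- Every tuple with these shared values inherits from `r₀` the coincidences in the colors other
  -- than `j`.
  obtain ⟨r₀, hr₀, rfl⟩ := Finset.mem_image.1 hb
  simp only [coincidenceTuples, Finset.mem_filter, Fintype.mem_piFinset] at hr₀
  ext r
  simp only [coincidenceTuples, Finset.mem_filter, Fintype.mem_piFinset]
  constructor
  · rintro ⟨⟨h1, h2⟩, h3⟩
    refine ⟨fun v => ⟨h1 v, fun i hi => ?_⟩, fun v w hvw => ?_⟩
    · have := congrFun (congrFun h3 v) i
      simpa only [sharedValues, if_pos hi] using this
    · rcases (hker v w).1 hvw with rfl | hadj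
      · rfl
      · exact h2 j v w hadj
  · rintro ⟨h1, h2⟩
    refine ⟨⟨fun v => (h1 v).1, fun i v w hvw => ?_⟩, ?_⟩
    · rcases eq_or_ne i j with rfl | hij
      · exact h2 v w ((hker v w).2 (Or.inr hvw))
      · have hv : i ∈ sharedCoords adj j v := by
          simp only [sharedCoords, Finset.mem_filter, Finset.mem_univ, true_and]
          exact ⟨hij, w, hvw⟩
        have hw : i ∈ sharedCoords adj j w := by
          simp only [sharedCoords, Finset.mem_filter, Finset.mem_univ, true_and]
          exact ⟨hij, v, h.symm _ _ _ hvw⟩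
        rw [(h1 v).2 i hv, (h1 w).2 i hw]
        simp only [sharedValues, if_pos hv, if_pos hw]
        exact hr₀.2 i v w hvw
    · funext v i
      by_cases hv : i ∈ sharedCoords adj j v
      · rw [← (h1 v).2 i hv]
        simp only [sharedValues, if_pos hv]
      · simp only [sharedValues, if_neg hv]

open Classical in
/-- The sum over all tuples with coincidences, arranged by the values of the coordinates which are
shared in the colors other than `j`, factors over the cliques of color `j`. -/
theorem sum_coincidenceTuples_eq {T : Type} [Fintype T] {π : V → T} (hπ : π.Surjective)
    (A : V → Finset (Fin d → ℕ)) {j : Fin d} {n : ℕ} (hA : ∀ v, ∀ r ∈ A v, r j ≤ n)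
    (h : CliqueRelations adj) (hker : ∀ v w, π v = π w ↔ v = w ∨ adj j v w)
    (g : (Fin d → ℕ) → ℝ) :
    ∑ r ∈ coincidenceTuples adj A, ∏ v, g (r v) =
      ∑ b ∈ (coincidenceTuples adj A).image (sharedValues adj j),
        ∏ t, ∑ a : Fin (n + 1), ∏ v ∈ Finset.univ.filter (fun v => π v = t),
          ∑ r ∈ ((A v).filter fun r => ∀ i ∈ sharedCoords adj j v, r i = b v i).filter
            (fun r => r j = (a : ℕ)), g r := by
  rw [← Finset.sum_fiberwise_of_maps_to (t := (coincidenceTuples adj A).image (sharedValues adj j))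
    (g := sharedValues adj j) (fun r hr => Finset.mem_image_of_mem _ hr)]
  refine Finset.sum_congr rfl fun b hb => ?_
  rw [filter_sharedValues_eq A h hker hb]
  exact sum_prod_eq_prod_fiber hπ _ j (fun v r hr => hA v r (Finset.mem_filter.1 hr).1) g

open Classical in
/-- Each clique accounts for a single free value, and has at least two elements. -/
theorem card_sharedValues_sq_le [LinearOrder V] (A : V → Finset (Fin d → ℕ)) (j : Fin d) {n : ℕ}
    (hA : ∀ v, ∀ r ∈ A v, ∀ i, r i ≤ n) (h : CliqueRelations adj) :
    ((coincidenceTuples adj A).image (sharedValues adj j)).card ^ 2 ≤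
      (n + 1) ^ ∑ v, (sharedCoords adj j v).card := by
  set B := (coincidenceTuples adj A).image (sharedValues adj j)
  set Sh : Finset (Σ _ : V, Fin d) := Finset.univ.sigma fun v => sharedCoords adj j v with hSh
  -- The least vertex of each nontrivial clique, one for each free value.
  set R : Finset (Σ _ : V, Fin d) := Sh.filter fun x => ∀ w, adj x.2 x.1 w → x.1 < w with hR
  have hmem : ∀ v i, i ∈ sharedCoords adj j v ↔ i ≠ j ∧ ∃ w, adj i v w := fun v i => by
    simp [sharedCoords]
  have hShmem : ∀ v i, (⟨v, i⟩ : Σ _ : V, Fin d) ∈ Sh ↔ i ≠ j ∧ ∃ w, adj i v w := fun v i => by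
    simp [hSh, hmem]
  have hB : B.card ≤ (n + 1) ^ R.card := by
    have h1 : (Finset.univ : Finset (R → Fin (n + 1))).card = (n + 1) ^ R.card := by
      simp
    rw [← h1]
    refine Finset.card_le_card_of_injOn
      (fun b x => Fin.ofNat (n + 1) (b x.1.1 x.1.2)) (fun _ _ => by simp) ?_
    intro b hb b' hb' hbb'
    obtain ⟨r, hr, rfl⟩ := Finset.mem_image.1 hb
    obtain ⟨r', hr', rfl⟩ := Finset.mem_image.1 hb'
    simp only [coincidenceTuples, Finset.mem_filter, Fintype.mem_piFinset] at hr hr'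
    funext v i
    by_cases hv : i ∈ sharedCoords adj j v
    · obtain ⟨hij, w, hw⟩ := (hmem v i).1 hv
      obtain ⟨m, hm, hmin⟩ := (Finset.univ.filter fun w => v = w ∨ adj i v w).exists_min_image id
        ⟨v, by simp⟩
      simp only [Finset.mem_filter, Finset.mem_univ, true_and, id] at hm hmin
      have hmw : ∃ w, adj i m w := by
        rcases hm with rfl | hm
        · exact ⟨w, hw⟩
        · exact ⟨v, h.symm _ _ _ hm⟩
      have hmSh : (⟨m, i⟩ : Σ _ : V, Fin d) ∈ Sh := (hShmem m i).2 ⟨hij, hmw⟩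
      have hmR : (⟨m, i⟩ : Σ _ : V, Fin d) ∈ R := by
        refine Finset.mem_filter.2 ⟨hmSh, fun u hu => lt_of_le_of_ne (hmin u ?_) ?_⟩
        · exact (h.setoid i).iseqv.trans hm (Or.inr hu)
        · rintro rfl
          exact h.irrefl _ _ hu
      have h2 := congrFun hbb' ⟨_, hmR⟩
      have hms : i ∈ sharedCoords adj j m := (hmem m i).2 ⟨hij, hmw⟩
      simp only [sharedValues, if_pos hms, Fin.ext_iff, Fin.val_ofNat] at h2
      rw [Nat.mod_eq_of_lt (Nat.lt_succ_of_le (hA _ _ (hr.1 m) i)),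
        Nat.mod_eq_of_lt (Nat.lt_succ_of_le (hA _ _ (hr'.1 m) i))] at h2
      simp only [sharedValues, if_pos hv]
      rcases hm with rfl | hm
      · exact h2
      · rw [hr.2 i v m hm, hr'.2 i v m hm, h2]
    · simp only [sharedValues, if_neg hv]
  have hR2 : 2 * R.card ≤ Sh.card := by
    -- A least vertex is sent to some neighbor, which is not least in its clique. Two least vertices
    -- with a common neighbor lie in one clique, hence coincide.
    have h1 : R.card ≤ (Sh \ R).card := by
      have hex : ∀ x : Σ _ : V, Fin d, ∃ w, x ∈ R → adj x.2 x.1 w := fun x => by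
        by_cases hx : x ∈ R
        · obtain ⟨w, hw⟩ := ((hShmem x.1 x.2).1 (Finset.mem_filter.1 hx).1).2
          exact ⟨w, fun _ => hw⟩
        · exact ⟨x.1, fun h => absurd h hx⟩
      choose φ hφ using hex
      refine Finset.card_le_card_of_injOn (fun x => ⟨φ x, x.2⟩) (fun x hx => ?_)
        fun x hx y hy hxy => ?_
      · have hx' : x ∈ R := hx
        have hxφ := hφ x hx'
        have hx1 := Finset.mem_filter.1 hx'
        refine Finset.mem_coe.2 (Finset.mem_sdiff.2 ⟨(hShmem _ _).2
          ⟨((hShmem x.1 x.2).1 hx1.1).1, x.1, h.symm _ _ _ hxφ⟩, fun hmR => ?_⟩)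
        have h3 := (Finset.mem_filter.1 hmR).2 x.1 (h.symm _ _ _ hxφ)
        exact lt_asymm h3 (hx1.2 _ hxφ)
      · have hx' : x ∈ R := hx
        have hy' : y ∈ R := hy
        obtain ⟨v, i⟩ := x
        obtain ⟨w, i'⟩ := y
        simp only [Sigma.mk.injEq, heq_eq_eq] at hxy
        obtain ⟨h3, rfl⟩ := hxy
        have h4 := hφ _ hx'
        have h5 := hφ _ hy'
        simp only at h4 h5
        rw [← h3] at h5
        have hvw : v = w := by
          by_contra hne
          have h6 := h.trans _ _ _ _ h4 (h.symm _ _ _ h5) hne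
          exact lt_asymm ((Finset.mem_filter.1 hx').2 _ h6)
            ((Finset.mem_filter.1 hy').2 _ (h.symm _ _ _ h6))
        rw [hvw]
    have hRS : R ⊆ Sh := Finset.filter_subset _ _
    rw [Finset.card_sdiff_of_subset hRS] at h1
    have h2 : R.card ≤ Sh.card := Finset.card_le_card hRS
    omega
  rw [← Finset.card_sigma]
  calc B.card ^ 2 ≤ ((n + 1) ^ R.card) ^ 2 := Nat.pow_le_pow_left hB 2
    _ = (n + 1) ^ (2 * R.card) := by rw [← pow_mul, mul_comm]
    _ ≤ (n + 1) ^ Sh.card := Nat.pow_le_pow_right (by omega) hR2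

end Combinatorics

theorem le_ofReal_of_sq_le {e : ℝ≥0∞} {z : ℝ} (hz : 0 ≤ z) (h : e ^ 2 ≤ ENNReal.ofReal (z ^ 2)) :
    e ≤ ENNReal.ofReal z := by
  rw [ENNReal.ofReal_pow hz] at h
  exact (ENNReal.pow_le_pow_left_iff two_ne_zero).1 h

/-! ### Vectors with fixed coordinate sum, and the choice of a color. -/

section Vectors

variable {d : ℕ}

theorem le_of_sum_eq {n : ℕ} {r : Fin d → ℕ} (hr : ∑ i, r i = n) (i : Fin d) : r i ≤ n :=
  hr ▸ Finset.single_le_sum (fun i _ => Nat.zero_le (r i)) (Finset.mem_univ i)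

/-- Two vectors with the same sum of coordinates that agree outside of the coordinates `i`
and `j`. -/
theorem add_eq_add_of_sum_eq {n : ℕ} {r s : Fin d → ℕ} (hr : ∑ l, r l = n) (hs : ∑ l, s l = n)
    {i j : Fin d} (hij : i ≠ j) (h : ∀ l, l ≠ i → l ≠ j → r l = s l) :
    r j + r i = s j + s i := by
  have hj : j ∈ Finset.univ.erase i := Finset.mem_erase.2 ⟨hij.symm, Finset.mem_univ _⟩
  rw [← Finset.add_sum_erase _ _ (Finset.mem_univ i), ← Finset.add_sum_erase _ _ hj] at hr hs
  have : ∑ l ∈ (Finset.univ.erase i).erase j, r l = ∑ l ∈ (Finset.univ.erase i).erase j, s l := by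
    refine Finset.sum_congr rfl fun l hl => ?_
    simp only [Finset.mem_erase] at hl
    exact h l hl.2.1 hl.1
  omega

end Vectors

section Colors

variable {V : Type} [Fintype V] {d : ℕ} {adj : Fin d → V → V → Prop}

open Classical in
/-- Some color covers a proportion `1 / (d - 1)` of the vertices. -/
theorem exists_color_card_le {i : Fin d} (hd : 2 ≤ d) (hi : ∀ v w, ¬adj i v w)
    (hcov : ∀ v, ∃ l w, adj l v w) :
    ∃ j, i ≠ j ∧ Fintype.card V ≤
      (d - 1) * (Finset.univ.filter fun v => ∃ w, adj j v w).card := by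
  by_contra hcon
  push Not at hcon
  have h1 : Fintype.card V ≤
      ∑ j ∈ Finset.univ.erase i, (Finset.univ.filter fun v => ∃ w, adj j v w).card := by
    refine le_trans ?_ Finset.card_biUnion_le
    rw [← Finset.card_univ]
    refine Finset.card_le_card fun v _ => ?_
    obtain ⟨l, w, hl⟩ := hcov v
    simp only [Finset.mem_biUnion, Finset.mem_erase, Finset.mem_filter, Finset.mem_univ, true_and,
      and_true]
    exact ⟨l, fun h => hi v w (h ▸ hl), w, hl⟩
  have hcard : (Finset.univ.erase i).card = d - 1 := by
    rw [Finset.card_erase_of_mem (Finset.mem_univ _), Finset.card_univ, Fintype.card_fin]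
  have h2 : ∑ j ∈ Finset.univ.erase i,
      (d - 1) * (Finset.univ.filter fun v => ∃ w, adj j v w).card <
      ∑ j ∈ Finset.univ.erase i, Fintype.card V := by
    refine Finset.sum_lt_sum_of_nonempty (Finset.card_pos.1 (by omega)) fun j hj => ?_
    exact hcon j (Finset.ne_of_mem_erase hj).symm
  rw [← Finset.mul_sum, Finset.sum_const, hcard, smul_eq_mul] at h2
  have h3 := Nat.mul_le_mul_left (d - 1) h1
  omega

-- Ensures that the natural number subtraction in the exponents `d - 1 - card` does not truncate.
open Classical in
theorem card_sharedCoords_add_le {i j : Fin d} (hij : i ≠ j) (hi : ∀ v w, ¬adj i v w) (v : V) :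
    (sharedCoords adj j v).card + 2 ≤ d := by
  have h1 : sharedCoords adj j v ⊆ (Finset.univ.erase i).erase j := fun l hl => by
    simp only [sharedCoords, Finset.mem_filter, Finset.mem_univ, true_and] at hl
    obtain ⟨hlj, w, hw⟩ := hl
    simp only [Finset.mem_erase, Finset.mem_univ, and_true]
    exact ⟨hlj, fun h => hi v w (h ▸ hw)⟩
  have h2 := Finset.card_le_card h1
  have hj : j ∈ Finset.univ.erase i := Finset.mem_erase.2 ⟨hij.symm, Finset.mem_univ _⟩
  have h3 := Finset.card_erase_add_one hj
  have h4 := Finset.card_erase_add_one (Finset.mem_univ i)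
  rw [Finset.card_univ, Fintype.card_fin] at h4
  omega

end Colors

/-! ### The bound for one clique and its assembly over the graph. -/

section Clique

variable {Ω : Type*} [MeasurableSpace Ω] {μ : Measure Ω} {d : ℕ}
  {f : (Fin d → ℕ) → Ω → ℝ} {θ : Fin d → ℕ → Ω → Ω} {V : Type} [LinearOrder V]

/-- The contribution of one clique of color `j`, when the other shared coordinates are fixed. -/
theorem eLpNorm_clique_le [IsProbabilityMeasure μ] (H : HaarSystem μ f θ) {k n : ℕ} (hk : k ≠ 0)
    {i j : Fin d} (hij : i ≠ j) {C : V → Finset (Fin d → ℕ)} {K : V → Finset (Fin d)}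
    (hKi : ∀ v, i ∉ K v) (hKj : ∀ v, j ∉ K v) (hsum : ∀ v, ∀ r ∈ C v, ∑ l, r l = n)
    (hfix : ∀ v, ∀ r ∈ C v, ∀ s ∈ C v, ∀ l ∈ K v, r l = s l)
    (hsep : ∀ v w, v < w → ∀ r ∈ C v, ∀ s ∈ C w, r i < s i) {Q : Finset V} (hQ : Q.Nonempty)
    {P : ℝ≥0∞} (hP1 : 1 ≤ P) (hP : Q.card * P ≤ ((2 * k : ℕ) : ℝ≥0∞)) :
    eLpNorm (fun x => ∑ a : Fin (n + 1), ∏ v ∈ Q,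
        famSum f ((C v).filter fun r => r j = a) x) P μ ≤
      ENNReal.ofReal (∏ v ∈ Q, (Real.sqrt (((8 * (k : ℝ) + 1) * (n + 1)) ^ (d - 1 - (K v).card)) *
        if Q.card = 1 then 1 else ((n : ℝ) + 1) ^ (-(1 / 8) : ℝ))) := by
  set T : ℝ := (8 * (k : ℝ) + 1) * (n + 1) with hT
  have hn1 : (1 : ℝ) ≤ n + 1 := by have : (0 : ℝ) ≤ n := n.cast_nonneg
                                   linarith
  have hnT : (n : ℝ) + 1 ≤ T := by
    have : (0 : ℝ) ≤ k := k.cast_nonneg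
    rw [hT]; nlinarith
  have hT0 : 0 ≤ T := by linarith
  set δ : ℝ := ((n : ℝ) + 1) ^ (-(1 / 8) : ℝ) with hδ
  have hδ0 : 0 ≤ δ := by positivity
  -- The free coordinates besides `j`; the coordinate `i` is determined by the sum of the others.
  set L : V → Finset (Fin d) := fun v => Finset.univ \ insert i (insert j (K v)) with hL
  have hLcard : ∀ v, d - 1 - (K v).card = (L v).card + 1 := by
    intro v
    have h1 : (insert i (insert j (K v))).card = (K v).card + 2 := by
      rw [Finset.card_insert_of_notMem, Finset.card_insert_of_notMem (hKj v)]
      simp [hij, hKi v]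
    have h2 := Finset.card_le_univ (insert i (insert j (K v)))
    have h3 := Finset.card_sdiff_of_subset (Finset.subset_univ (insert i (insert j (K v))))
    rw [Finset.card_univ, Fintype.card_fin] at h3
    rw [Fintype.card_fin] at h2
    simp only [hL]
    omega
  have hle : ∀ v, ∀ r ∈ C v, ∀ l, r l ≤ n := fun v r hr l => le_of_sum_eq (hsum v r hr) l
  have hadd : ∀ v, ∀ r ∈ C v, ∀ s ∈ C v, (∀ l ∈ L v, r l = s l) → ∀ l, l ≠ i → l ≠ j →
      r l = s l := by
    intro v r hr s hs h l hli hlj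
    by_cases hl : l ∈ K v
    · exact hfix v r hr s hs l hl
    · exact h l (by simp [hL, hli, hlj, hl])
  have hpair : ∀ v, ∀ r ∈ C v, ∀ s ∈ C v, (∀ l ∈ L v, r l = s l) → r j + r i = s j + s i :=
    fun v r hr s hs h =>
      add_eq_add_of_sum_eq (hsum v r hr) (hsum v s hs) hij (hadd v r hr s hs h)
  have hdet : ∀ v, ∀ r ∈ C v, ∀ s ∈ C v, (∀ l ∈ L v, r l = s l) → r j = s j → r = s := by
    intro v r hr s hs h hj
    have h1 := hpair v r hr s hs h
    funext l
    rcases eq_or_ne l i with rfl | hli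
    · omega
    rcases eq_or_ne l j with rfl | hlj
    · exact hj
    exact hadd v r hr s hs h l hli hlj
  have hsq : ∀ m : ℕ, 0 ≤ Real.sqrt (T ^ m) := fun m => Real.sqrt_nonneg _
  have hsqs : ∀ m : ℕ, Real.sqrt (T ^ m) ^ 2 = T ^ m := fun m => Real.sq_sqrt (by positivity)
  have hbound : ∀ v, ∀ S ⊆ C v, ∀ L' : Finset (Fin d),
      (∀ r ∈ S, ∀ s ∈ S, (∀ l ∈ L', r l = s l) → r = s) →
      eLpNorm (famSum f S) ((4 * k : ℕ) : ℝ≥0∞) μ ≤ ENNReal.ofReal (Real.sqrt (T ^ L'.card)) := by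
    intro v S hS L' hL'
    refine le_ofReal_of_sq_le (hsq _) ?_
    rw [hsqs, ← eLpNorm_sq_eq]
    exact eLpNorm_famSum_sq_le H hk (fun r hr => hle v r (hS hr)) L' hL'
  have hk24 : ((2 * k : ℕ) : ℝ≥0∞) ≤ ((4 * k : ℕ) : ℝ≥0∞) := by
    exact_mod_cast (by omega : 2 * k ≤ 4 * k)
  have hPk : P ≤ ((2 * k : ℕ) : ℝ≥0∞) := by
    refine le_trans ?_ hP
    have : (1 : ℝ≥0∞) ≤ Q.card := by exact_mod_cast hQ.card_pos
    calc P = 1 * P := (one_mul P).symm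
      _ ≤ _ := by gcongr
  simp only [hLcard]
  have hcases : Q.card = 1 ∨ Q.card = 2 ∨ 3 ≤ Q.card := by have := hQ.card_pos; omega
  rcases hcases with h1 | h2 | h3
  -- An isolated vertex: `j` is one more free coordinate, and there is no gain.
  · obtain ⟨v, rfl⟩ := Finset.card_eq_one.1 h1
    simp only [Finset.prod_singleton, Finset.card_singleton, if_true, mul_one]
    have h4 : (fun x => ∑ a : Fin (n + 1), famSum f ((C v).filter fun r => r j = a) x) =
        famSum f (C v) := by
      funext x
      simp only [famSum]
      rw [← Finset.sum_fiberwise_of_maps_to (s := C v) (t := Finset.range (n + 1))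
        (g := fun r => r j) (fun r hr => Finset.mem_range.2 (Nat.lt_succ_of_le (hle v r hr j))),
        Finset.sum_range]
    rw [h4]
    refine (eLpNorm_le_eLpNorm_of_exponent_le (hPk.trans hk24)
      (H.bddMeasurable_famSum _).aesm).trans ((hbound v _ subset_rfl (insert j (L v)) ?_).trans
      (le_of_eq ?_))
    · exact fun r hr s hs h => hdet v r hr s hs (fun l hl => h l (Finset.mem_insert_of_mem hl))
        (h j (Finset.mem_insert_self _ _))
    · rw [Finset.card_insert_of_notMem (by simp [hL])]
  · obtain ⟨v, w, hvw, hQvw⟩ : ∃ v w, v < w ∧ Q = {v, w} := by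
      obtain ⟨v, w, hvw, hQvw⟩ := Finset.card_eq_two.1 h2
      rcases lt_or_gt_of_ne hvw with h | h
      · exact ⟨v, w, h, hQvw⟩
      · exact ⟨w, v, h, by rw [hQvw, Finset.pair_comm]⟩
    have hne := hvw.ne
    have h5 := eLpNorm_pair_sq_le H hk (j := j) (hle v) (hle w) (hsep v w hvw) (hdet v)
      (hdet w) (hpair w)
    have h6 : eLpNorm (fun x => ∑ a : Fin (n + 1), ∏ v ∈ Q,
        famSum f ((C v).filter fun r => r j = a) x) P μ ≤
        ENNReal.ofReal ((Real.sqrt (T ^ ((L v).card + 1)) * δ) *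
          (Real.sqrt (T ^ ((L w).card + 1)) * δ)) := by
      simp only [hQvw, Finset.prod_pair hne]
      refine (eLpNorm_le_eLpNorm_of_exponent_le hPk (BddMeasurable.sum fun a _ =>
        (H.bddMeasurable_famSum _).mul (H.bddMeasurable_famSum _)).aesm).trans ?_
      refine le_ofReal_of_sq_le (by positivity) (h5.trans (ENNReal.ofReal_le_ofReal
        (le_of_eq ?_)))
      have hexpand : ∀ y z : ℝ, (y * δ * (z * δ)) ^ 2 = y ^ 2 * z ^ 2 * (δ ^ 2 * δ ^ 2) :=
        fun y z => by ring
      rw [hexpand, hsqs, hsqs]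
      -- The gain `√(n + 1)` in the squared norm of a pair is shared by two vertices, hence the
      -- exponent `1 / 8`.
      have hδ4 : δ ^ 2 * δ ^ 2 = (Real.sqrt (n + 1))⁻¹ := by
        rw [hδ, Real.sqrt_eq_rpow, ← Real.rpow_neg (by positivity), ← pow_add,
          ← Real.rpow_natCast, ← Real.rpow_mul (by positivity)]
        norm_num
      rw [hδ4, div_eq_mul_inv]
    refine h6.trans (le_of_eq ?_)
    rw [if_neg (by omega), hQvw, Finset.prod_pair hne]
  -- Three or more vertices: the sum over the common value costs `n + 1`, while each vertex is
  -- allowed `√T * δ ≥ (n + 1) ^ (3 / 8)`, and `3 * (3 / 8) ≥ 1`.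
  · have h4 : ∀ a ∈ (Finset.univ : Finset (Fin (n + 1))),
        eLpNorm (fun x => ∏ v ∈ Q, famSum f ((C v).filter fun r => r j = a) x) P μ ≤
        ENNReal.ofReal (∏ v ∈ Q, Real.sqrt (T ^ (L v).card)) := by
      intro a _
      refine (eLpNorm_prod_le_prod (fun v _ => (H.bddMeasurable_famSum _).aesm)
        (by exact_mod_cast (by omega : 4 * k ≠ 0)) (hP.trans hk24)).trans ?_
      rw [ENNReal.ofReal_prod_of_nonneg fun v _ => hsq _]
      refine Finset.prod_le_prod' fun v _ => hbound v _ (Finset.filter_subset _ _) _ ?_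
      intro r hr s hs hrs
      rw [Finset.mem_filter] at hr hs
      exact hdet v r hr.1 s hs.1 hrs (hr.2.trans hs.2.symm)
    have h5 := eLpNorm_sum_le (μ := μ) (p := P) (s := Finset.univ)
      (f := fun (a : Fin (n + 1)) x => ∏ v ∈ Q, famSum f ((C v).filter fun r => r j = a) x)
      (fun a _ => (BddMeasurable.prod fun v _ => H.bddMeasurable_famSum _).aesm) hP1
    have h6 : (∑ a : Fin (n + 1), fun x => ∏ v ∈ Q, famSum f ((C v).filter fun r => r j = a) x) =
        fun x => ∑ a : Fin (n + 1), ∏ v ∈ Q, famSum f ((C v).filter fun r => r j = a) x := by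
      ext x; simp
    rw [h6] at h5
    refine h5.trans ((Finset.sum_le_sum h4).trans ?_)
    rw [Finset.sum_const, Finset.card_univ, Fintype.card_fin, nsmul_eq_mul,
      ← ENNReal.ofReal_natCast, ← ENNReal.ofReal_mul (by positivity)]
    refine ENNReal.ofReal_le_ofReal ?_
    rw [if_neg (by omega)]
    have h7 : ∏ v ∈ Q, (Real.sqrt (T ^ ((L v).card + 1)) * δ) =
        (∏ v ∈ Q, Real.sqrt (T ^ (L v).card)) * (Real.sqrt T * δ) ^ Q.card := by
      rw [← Finset.prod_const, ← Finset.prod_mul_distrib]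
      refine Finset.prod_congr rfl fun v _ => ?_
      rw [pow_succ, Real.sqrt_mul (by positivity), mul_assoc]
    rw [h7, mul_comm]
    refine mul_le_mul_of_nonneg_left ?_ (Finset.prod_nonneg fun v _ => hsq _)
    have h8 : ((n : ℝ) + 1) ^ (3 / 8 : ℝ) ≤ Real.sqrt T * δ := by
      have : ((n : ℝ) + 1) ^ (3 / 8 : ℝ) = Real.sqrt (n + 1) * δ := by
        rw [hδ, Real.sqrt_eq_rpow, ← Real.rpow_add (by positivity)]
        norm_num
      rw [this]
      gcongr
    have h9 : (1 : ℝ) ≤ ((n : ℝ) + 1) ^ (3 / 8 : ℝ) := Real.one_le_rpow hn1 (by norm_num)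
    push_cast
    calc (n : ℝ) + 1 = ((n : ℝ) + 1) ^ (1 : ℝ) := (Real.rpow_one _).symm
      _ ≤ ((n : ℝ) + 1) ^ ((3 / 8 : ℝ) * (3 : ℕ)) :=
          Real.rpow_le_rpow_of_exponent_le hn1 (by norm_num)
      _ = (((n : ℝ) + 1) ^ (3 / 8 : ℝ)) ^ 3 := by
          rw [Real.rpow_mul (by positivity), Real.rpow_natCast]
      _ ≤ (((n : ℝ) + 1) ^ (3 / 8 : ℝ)) ^ Q.card := pow_le_pow_right₀ h9 h3
      _ ≤ (Real.sqrt T * δ) ^ Q.card := by gcongr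

variable [Fintype V] {adj : Fin d → V → V → Prop}

open Classical in
/-- The gain for coincidences. -/
theorem eLpNorm_coincidence_le [IsProbabilityMeasure μ] (H : HaarSystem μ f θ) {k n : ℕ}
    (hk : k ≠ 0) (hd : 2 ≤ d) {i : Fin d} {A : V → Finset (Fin d → ℕ)}
    (hsum : ∀ v, ∀ r ∈ A v, ∑ l, r l = n)
    (hsep : ∀ v w, v < w → ∀ r ∈ A v, ∀ s ∈ A w, r i < s i) (hadj : CliqueRelations adj)
    (hi : ∀ v w, ¬adj i v w) (hcov : ∀ v, ∃ l w, adj l v w) {p : ℝ≥0∞} (hp1 : 1 ≤ p)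
    (hp : ((Fintype.card V + 1) ^ 2 : ℕ) * p ≤ ((2 * k : ℕ) : ℝ≥0∞)) :
    eLpNorm (fun x => ∑ r ∈ coincidenceTuples adj A, ∏ v, f (r v) x) p μ ≤
      ENNReal.ofReal (Real.sqrt (((8 * (k : ℝ) + 1) * (n + 1)) ^ ((d - 1) * Fintype.card V)) *
        ((n : ℝ) + 1) ^ (-(Fintype.card V / (8 * ((d : ℝ) - 1))))) := by
  obtain ⟨j, hij, hj⟩ := exists_color_card_le hd hi hcov
  set N := Fintype.card V with hN
  set T : ℝ := (8 * (k : ℝ) + 1) * (n + 1) with hT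
  have hn1 : (1 : ℝ) ≤ n + 1 := by have : (0 : ℝ) ≤ n := n.cast_nonneg
                                   linarith
  have hnT : (n : ℝ) + 1 ≤ T := by
    have : (0 : ℝ) ≤ k := k.cast_nonneg
    rw [hT]; nlinarith
  have hT0 : 0 ≤ T := by linarith
  set δ : ℝ := ((n : ℝ) + 1) ^ (-(1 / 8) : ℝ) with hδ
  have hδ0 : 0 ≤ δ := by positivity
  set K := sharedCoords adj j with hK
  set B := (coincidenceTuples adj A).image (sharedValues adj j) with hB
  set C : (V → Fin d → ℕ) → V → Finset (Fin d → ℕ) := fun b v =>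
    (A v).filter fun r => ∀ l ∈ K v, r l = b v l with hC
  obtain ⟨Q, _, π, hπs, hker⟩ := hadj.exists_quotient j
  set g : (V → Fin d → ℕ) → Q → Ω → ℝ := fun b t x =>
    ∑ a : Fin (n + 1), ∏ v ∈ Finset.univ.filter (fun v => π v = t),
      famSum f ((C b v).filter fun r => r j = a) x with hg
  have hgb : ∀ b t, BddMeasurable (g b t) := fun b t => BddMeasurable.sum fun a _ =>
    BddMeasurable.prod fun v _ => H.bddMeasurable_famSum _
  have hsplit : (fun x => ∑ r ∈ coincidenceTuples adj A, ∏ v, f (r v) x) =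
      ∑ b ∈ B, fun x => ∏ t, g b t x := by
    funext x
    rw [Finset.sum_apply]
    exact sum_coincidenceTuples_eq hπs A (fun v r hr => le_of_sum_eq (hsum v r hr) j) hadj hker
      fun r => f r x
  set ω : V → ℝ := fun v => Real.sqrt (T ^ (d - 1 - (K v).card)) *
    (if ∃ w, adj j v w then δ else 1) with hω
  have hω0 : ∀ v, 0 ≤ ω v := fun v => by
    simp only [hω]; split_ifs <;> positivity
  have hKi : ∀ v, i ∉ K v := fun v h => by
    simp only [hK, sharedCoords, Finset.mem_filter] at h
    obtain ⟨-, -, w, hw⟩ := h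
    exact hi v w hw
  have hKj : ∀ v, j ∉ K v := fun v h => by
    simp only [hK, sharedCoords, Finset.mem_filter] at h
    exact h.2.1 rfl
  have hp0 : p ≠ 0 := (zero_lt_one.trans_le hp1).ne'
  have hterm : ∀ b ∈ B, eLpNorm (fun x => ∏ t, g b t x) p μ ≤ ENNReal.ofReal (∏ v, ω v) := by
    intro b hb
    have hcardT : Fintype.card Q ≤ N :=
      Fintype.card_le_of_surjective π hπs
    -- Hölder is used across the cliques and again inside a clique, each time losing a factor of at
    -- most `N + 1` in the exponent.
    set P : ℝ≥0∞ := ((N + 1 : ℕ) : ℝ≥0∞) * p with hPdef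
    have hN1 : (1 : ℝ≥0∞) ≤ ((N + 1 : ℕ) : ℝ≥0∞) := by exact_mod_cast Nat.le_add_left 1 N
    have hPp : p ≤ P := by
      calc p = 1 * p := (one_mul p).symm
        _ ≤ P := by rw [hPdef]; gcongr
    refine (eLpNorm_prod_le_prod (P := P) (fun t _ => (hgb b t).aesm)
      (zero_lt_one.trans_le (hp1.trans hPp)).ne' ?_).trans ?_
    · rw [Finset.card_univ, hPdef]
      gcongr
      omega
    have hω' : ∏ v, ω v = ∏ t, ∏ v ∈ Finset.univ.filter (fun v => π v = t), ω v :=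
      (Finset.prod_fiberwise Finset.univ π ω).symm
    rw [hω', ENNReal.ofReal_prod_of_nonneg fun t _ => Finset.prod_nonneg fun v _ => hω0 v]
    refine Finset.prod_le_prod' fun t _ => ?_
    have hQ : (Finset.univ.filter (fun v => π v = t)).Nonempty := by
      obtain ⟨v, hv⟩ := hπs t
      exact ⟨v, by simp [hv]⟩
    refine (eLpNorm_clique_le H hk hij (C := C b) hKi hKj
      (fun v r hr => hsum v r (Finset.mem_filter.1 hr).1)
      (fun v r hr s hs l hl => by
        rw [(Finset.mem_filter.1 hr).2 l hl, (Finset.mem_filter.1 hs).2 l hl])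
      (fun v w hvw r hr s hs =>
        hsep v w hvw r (Finset.mem_filter.1 hr).1 s (Finset.mem_filter.1 hs).1)
      hQ (hp1.trans hPp) ?_).trans (le_of_eq ?_)
    · refine le_trans ?_ hp
      have h1 : (Finset.univ.filter (fun v => π v = t)).card ≤ N + 1 :=
        (Finset.card_le_univ _).trans (Nat.le_succ _)
      rw [hPdef, ← mul_assoc, ← Nat.cast_mul, sq]
      gcongr
    · congr 1
      refine Finset.prod_congr rfl fun v hv => ?_
      rw [Finset.mem_filter] at hv
      simp only [hω]
      congr 1
      by_cases hsh : ∃ w, adj j v w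
      · obtain ⟨w, hw⟩ := hsh
        rw [if_pos (⟨w, hw⟩ : ∃ w, adj j v w), if_neg]
        intro h1
        have hw' : π w = t := by
          rw [← hv.2]
          exact (hker w v).2 (Or.inr (hadj.symm _ _ _ hw))
        have := Finset.card_le_one.1 h1.le v (by simp [hv.2]) w (by simp [hw'])
        exact hadj.irrefl j v (by rwa [← this] at hw)
      · rw [if_neg hsh, if_pos]
        rw [Finset.card_eq_one]
        refine ⟨v, Finset.eq_singleton_iff_unique_mem.2 ⟨by simp [hv.2], fun w hw => ?_⟩⟩
        have hvw : π v = π w := by rw [hv.2, (Finset.mem_filter.1 hw).2]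
        rcases (hker v w).1 hvw with h | h
        · exact h.symm
        · exact absurd ⟨w, h⟩ hsh
  rw [hsplit]
  refine (eLpNorm_sum_le (fun b _ => (BddMeasurable.prod fun t _ => hgb b t).aesm) hp1).trans
    ((Finset.sum_le_sum hterm).trans ?_)
  rw [Finset.sum_const, nsmul_eq_mul, ← ENNReal.ofReal_natCast,
    ← ENNReal.ofReal_mul (by positivity)]
  refine ENNReal.ofReal_le_ofReal ?_
  have hBcard : (B.card : ℝ) ≤ Real.sqrt (T ^ ∑ v, (K v).card) := by
    refine Real.le_sqrt_of_sq_le ?_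
    have h1 := card_sharedValues_sq_le A j (fun v r hr => le_of_sum_eq (hsum v r hr)) hadj
    calc ((B.card : ℝ)) ^ 2 ≤ ((n : ℝ) + 1) ^ ∑ v, (K v).card := by exact_mod_cast h1
      _ ≤ _ := by gcongr
  have hprod : ∏ v, ω v = Real.sqrt (T ^ ∑ v, (d - 1 - (K v).card)) *
      δ ^ (Finset.univ.filter fun v => ∃ w, adj j v w).card := by
    simp only [hω]
    rw [Finset.prod_mul_distrib, ← Finset.prod_pow_eq_pow_sum, Finset.prod_ite,
      Finset.prod_const, Finset.prod_const_one, mul_one]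
    congr 1
    rw [Real.sqrt_eq_rpow, ← Real.finsetProd_rpow _ _ fun v _ => by positivity]
    simp only [Real.sqrt_eq_rpow]
  rw [hprod, ← mul_assoc]
  -- Counted shared values and free coordinates together contribute exactly `d - 1` square-root
  -- factors per vertex.
  have hexp : ∑ v, (K v).card + ∑ v, (d - 1 - (K v).card) = (d - 1) * N := by
    rw [← Finset.sum_add_distrib, Finset.sum_congr rfl fun v _ => show
      (K v).card + (d - 1 - (K v).card) = d - 1 by
        have := card_sharedCoords_add_le hij hi v
        simp only [hK]
        omega]
    simp [hN, mul_comm]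
  have h1 : (B.card : ℝ) * Real.sqrt (T ^ ∑ v, (d - 1 - (K v).card)) ≤
      Real.sqrt (T ^ ((d - 1) * N)) := by
    rw [← hexp, pow_add, Real.sqrt_mul (by positivity)]
    gcongr
  refine mul_le_mul h1 ?_ (by positivity) (by positivity)
  rw [hδ, ← Real.rpow_natCast, ← Real.rpow_mul (by positivity)]
  refine Real.rpow_le_rpow_of_exponent_le hn1 ?_
  have hd1 : (0 : ℝ) < (d : ℝ) - 1 := by
    have : (2 : ℝ) ≤ d := by exact_mod_cast hd
    linarith
  have hj' : (N : ℝ) ≤ ((d : ℝ) - 1) * (Finset.univ.filter fun v => ∃ w, adj j v w).card := by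
    have h2 : ((d - 1 : ℕ) : ℝ) = (d : ℝ) - 1 := by
      rw [Nat.cast_sub (by omega)]; norm_num
    rw [← h2]
    exact_mod_cast hj
  have h3 : (N : ℝ) / (8 * ((d : ℝ) - 1)) ≤
      1 / 8 * (Finset.univ.filter fun v => ∃ w, adj j v w).card := by
    rw [div_le_iff₀ (by positivity)]
    linarith
  linarith

end Clique

/-! ### Flips of binary digits on the line. -/

section Flip

theorem mem_dyadicInterval_iff {k p : ℕ} {y : ℝ} :
    y ∈ dyadicInterval k p ↔ ⌊y * 2 ^ k⌋ = (p : ℤ) := by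
  have h2 : (0 : ℝ) < 2 ^ k := by positivity
  rw [dyadicInterval, Set.mem_Ico, div_le_iff₀ h2, lt_div_iff₀ h2, Int.floor_eq_iff]
  norm_cast

/-- The map on the line which changes the binary digit number `m + 1`. -/
noncomputable def digitFlip (m : ℕ) (y : ℝ) : ℝ :=
  if Even ⌊y * 2 ^ (m + 1)⌋ then y + (2 ^ (m + 1))⁻¹ else y - (2 ^ (m + 1))⁻¹

theorem floor_digitFlip (m : ℕ) (y : ℝ) : ⌊digitFlip m y * 2 ^ (m + 1)⌋ =
    if Even ⌊y * 2 ^ (m + 1)⌋ then ⌊y * 2 ^ (m + 1)⌋ + 1 else ⌊y * 2 ^ (m + 1)⌋ - 1 := by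
  have h2 : (2 : ℝ) ^ (m + 1) ≠ 0 := by positivity
  unfold digitFlip
  split_ifs
  · rw [add_mul, inv_mul_cancel₀ h2, Int.floor_add_one]
  · rw [sub_mul, inv_mul_cancel₀ h2, Int.floor_sub_one]

/-- Coarser floors come from `⌊y * 2 ^ (m + 1)⌋` by integer division, first by `2`, which forgets
exactly the flipped digit. -/
theorem floor_digitFlip_of_le {k m : ℕ} (hkm : k ≤ m) (y : ℝ) :
    ⌊digitFlip m y * 2 ^ k⌋ = ⌊y * 2 ^ k⌋ := by
  have key : ∀ z : ℝ, ⌊z * 2 ^ k⌋ = ⌊z * 2 ^ (m + 1)⌋ / 2 / ((2 ^ (m - k) : ℕ) : ℤ) := by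
    intro z
    have h1 : z * 2 ^ k = z * 2 ^ (m + 1) / ((2 * 2 ^ (m - k) : ℕ) : ℝ) := by
      rw [eq_div_iff (by positivity)]
      push_cast
      rw [mul_assoc, show (2 : ℝ) ^ k * (2 * 2 ^ (m - k)) = 2 * (2 ^ k * 2 ^ (m - k)) by ring,
        ← pow_add, Nat.add_sub_cancel' hkm, pow_succ, mul_comm (2 ^ m : ℝ) 2]
    rw [h1, Int.floor_div_natCast, Nat.cast_mul, ← Int.ediv_ediv_of_nonneg (by norm_num)]
    rfl
  rw [key, key y, floor_digitFlip]
  congr 1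
  split_ifs with h
  · obtain ⟨c, hc⟩ := h
    omega
  · rw [Int.not_even_iff_odd] at h
    obtain ⟨c, hc⟩ := h
    omega

theorem mem_dyadicInterval_digitFlip {k m p : ℕ} (hkm : k ≤ m) {y : ℝ} :
    digitFlip m y ∈ dyadicInterval k p ↔ y ∈ dyadicInterval k p := by
  rw [mem_dyadicInterval_iff, mem_dyadicInterval_iff, floor_digitFlip_of_le hkm]

theorem digitFlip_mem_left_iff {m p : ℕ} {y : ℝ} :
    digitFlip m y ∈ dyadicInterval (m + 1) (2 * p) ↔
      y ∈ dyadicInterval (m + 1) (2 * p + 1) := by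
  rw [mem_dyadicInterval_iff, mem_dyadicInterval_iff, floor_digitFlip]
  push_cast
  split_ifs with h
  · obtain ⟨c, hc⟩ := h
    omega
  · rw [Int.not_even_iff_odd] at h
    obtain ⟨c, hc⟩ := h
    omega

theorem digitFlip_mem_right_iff {m p : ℕ} {y : ℝ} :
    digitFlip m y ∈ dyadicInterval (m + 1) (2 * p + 1) ↔
      y ∈ dyadicInterval (m + 1) (2 * p) := by
  rw [mem_dyadicInterval_iff, mem_dyadicInterval_iff, floor_digitFlip]
  push_cast
  split_ifs with h
  · obtain ⟨c, hc⟩ := h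
    omega
  · rw [Int.not_even_iff_odd] at h
    obtain ⟨c, hc⟩ := h
    omega

open Classical in
theorem haar_eq_ite (k p : ℕ) (y : ℝ) : haar k p y =
    -(if y ∈ dyadicInterval (k + 1) (2 * p) then 1 else 0) +
      if y ∈ dyadicInterval (k + 1) (2 * p + 1) then 1 else 0 := by
  simp only [haar, Set.indicator_apply, Pi.one_apply]

theorem haar_digitFlip_of_lt {k m : ℕ} (hkm : k < m) (p : ℕ) (y : ℝ) :
    haar k p (digitFlip m y) = haar k p y := by
  classical
  simp only [haar_eq_ite, mem_dyadicInterval_digitFlip (Nat.succ_le_of_lt hkm)]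

theorem haar_digitFlip_self (m p : ℕ) (y : ℝ) :
    haar m p (digitFlip m y) = -haar m p y := by
  classical
  simp only [haar_eq_ite, digitFlip_mem_left_iff, digitFlip_mem_right_iff]
  ring

theorem measurableSet_even_floor (m : ℕ) : MeasurableSet {y : ℝ | Even ⌊y * 2 ^ (m + 1)⌋} := by
  have h : Measurable fun y : ℝ => ⌊y * 2 ^ (m + 1)⌋ :=
    Int.measurable_floor.comp (measurable_id.mul_const _)
  exact h (MeasurableSet.of_discrete (s := {z : ℤ | Even z}))

theorem measurable_digitFlip (m : ℕ) : Measurable (digitFlip m) :=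
  Measurable.ite (measurableSet_even_floor m) (measurable_id.add_const _)
    (measurable_id.sub_const _)

/-- The flip exchanges the set `E` of points with even floor and its complement, acting on each as a
translation. -/
theorem measurePreserving_digitFlip (m : ℕ) :
    MeasurePreserving (digitFlip m) (volume : Measure ℝ) volume := by
  refine ⟨measurable_digitFlip m, Measure.ext fun s hs => ?_⟩
  rw [Measure.map_apply (measurable_digitFlip m) hs]
  set E : Set ℝ := {y : ℝ | Even ⌊y * 2 ^ (m + 1)⌋} with hE
  have hEm : MeasurableSet E := measurableSet_even_floor m
  set δ : ℝ := (2 ^ (m + 1))⁻¹ with hδ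
  have h2 : (2 : ℝ) ^ (m + 1) ≠ 0 := by positivity
  have hadd : ∀ y, y + δ ∈ E ↔ y ∉ E := fun y => by
    simp only [hE, Set.mem_ofPred_eq, hδ, add_mul, inv_mul_cancel₀ h2, Int.floor_add_one]
    exact Int.even_add_one
  have hsub : ∀ y, y - δ ∈ E ↔ y ∉ E := fun y => by
    have := hadd (y - δ)
    rw [sub_add_cancel] at this
    tauto
  have e1 : digitFlip m ⁻¹' s ∩ E = (fun y => y + δ) ⁻¹' (s \ E) := by
    ext y
    by_cases hy : y ∈ E
    · have h3 : digitFlip m y = y + δ := if_pos hy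
      simp [h3, hy, hadd]
    · simp [hy, hadd]
  have e2 : digitFlip m ⁻¹' s \ E = (fun y => y + -δ) ⁻¹' (s ∩ E) := by
    ext y
    simp only [← sub_eq_add_neg]
    by_cases hy : y ∈ E
    · simp [hy, hsub]
    · have h3 : digitFlip m y = y - δ := if_neg hy
      simp [h3, hy, hsub]
  rw [← measure_inter_add_sdiff _ hEm, e1, e2, measure_preimage_add_right,
    measure_preimage_add_right, add_comm, measure_inter_add_sdiff _ hEm]

/-- The half-open interval is a dyadic interval of level `0`, hence invariant; the closed one is
not, since the point `1` is moved out of it. -/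
theorem measurePreserving_digitFlip_restrict (m : ℕ) :
    MeasurePreserving (digitFlip m) ((volume : Measure ℝ).restrict (Set.Icc 0 1))
      (volume.restrict (Set.Icc 0 1)) := by
  rw [← restrict_Ico_eq_restrict_Icc]
  have h1 : Set.Ico (0 : ℝ) 1 = dyadicInterval 0 0 := by simp [dyadicInterval]
  have h2 : digitFlip m ⁻¹' Set.Ico (0 : ℝ) 1 = Set.Ico 0 1 := by
    rw [h1]
    ext y
    exact mem_dyadicInterval_digitFlip (Nat.zero_le m)
  have h3 := (measurePreserving_digitFlip m).restrict_preimage (measurableSet_Ico (a := (0 : ℝ))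
    (b := 1))
  rwa [h2] at h3

end Flip

/-! ### The functions `f r` on the cube form a Haar system. -/

section Cube

variable {d : ℕ}

/-- The map on `ℝ ^ d` which changes one binary digit of one coordinate. -/
noncomputable def coordFlip (i : Fin d) (m : ℕ) (x : Fin d → ℝ) : Fin d → ℝ :=
  fun l => (if l = i then digitFlip m else id) (x l)

theorem volume_restrict_cube :
    (volume : Measure (Fin d → ℝ)).restrict (Set.Icc 0 1) =
      Measure.pi fun _ => (volume : Measure ℝ).restrict (Set.Icc 0 1) := by
  rw [← Measure.restrict_pi_pi, volume_pi]
  congr 1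
  exact (Set.pi_univ_Icc _ _).symm

theorem isProbabilityMeasure_cube :
    IsProbabilityMeasure ((volume : Measure (Fin d → ℝ)).restrict (Set.Icc 0 1)) := by
  have : IsProbabilityMeasure ((volume : Measure ℝ).restrict (Set.Icc 0 1)) := ⟨by simp⟩
  rw [volume_restrict_cube]
  infer_instance

theorem measurePreserving_coordFlip (i : Fin d) (m : ℕ) :
    MeasurePreserving (coordFlip i m) ((volume : Measure (Fin d → ℝ)).restrict (Set.Icc 0 1))
      (volume.restrict (Set.Icc 0 1)) := by
  rw [volume_restrict_cube]
  refine measurePreserving_pi _ _ fun l => ?_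
  split_ifs
  · exact measurePreserving_digitFlip_restrict m
  · exact MeasurePreserving.id _

theorem haarRect_coordFlip_of_lt {r : Fin d → ℕ} (R : Rect r) {i : Fin d} {m : ℕ} (h : r i < m)
    (x : Fin d → ℝ) : haarRect r R (coordFlip i m x) = haarRect r R x := by
  refine Finset.prod_congr rfl fun l _ => ?_
  simp only [coordFlip]
  split_ifs with hl
  · subst hl
    exact haar_digitFlip_of_lt h _ _
  · rfl

theorem haarRect_coordFlip_self {r : Fin d → ℕ} (R : Rect r) (i : Fin d) (x : Fin d → ℝ) :
    haarRect r R (coordFlip i (r i) x) = -haarRect r R x := by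
  have h1 : ∀ l, haar (r l) (R l) (coordFlip i (r i) x l) =
      (if l = i then -1 else 1) * haar (r l) (R l) (x l) := by
    intro l
    simp only [coordFlip]
    split_ifs with hl
    · subst hl
      rw [haar_digitFlip_self, neg_one_mul]
    · rw [id, one_mul]
  simp only [haarRect, h1, Finset.prod_mul_distrib, Finset.prod_ite_eq', Finset.mem_univ, if_true,
    neg_one_mul]

/-- Haar functions of one level have disjoint supports. -/
theorem sum_abs_haar_le_one (k : ℕ) (y : ℝ) : ∑ p : Fin (2 ^ k), |haar k p y| ≤ 1 := by
  classical
  have h1 : ∀ p : ℕ, |haar k p y| ≤ if (p : ℤ) = ⌊y * 2 ^ (k + 1)⌋ / 2 then 1 else 0 := by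
    intro p
    rw [haar_eq_ite]
    simp only [mem_dyadicInterval_iff]
    push_cast
    split_ifs <;> first | omega | norm_num
  by_cases h : ∃ p : Fin (2 ^ k), ((p : ℕ) : ℤ) = ⌊y * 2 ^ (k + 1)⌋ / 2
  · obtain ⟨p, hp⟩ := h
    rw [Finset.sum_eq_single p]
    · exact (h1 p).trans (by rw [if_pos hp])
    · intro p' _ hne
      have h2 := h1 p'
      rw [if_neg fun h3 => hne (Fin.ext (by omega))] at h2
      exact le_antisymm h2 (abs_nonneg _)
    · simp
  · push Not at h
    refine (Finset.sum_nonpos fun p _ => ?_).trans zero_le_one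
    exact (h1 p).trans (by rw [if_neg (h p)])

theorem measurable_haar (k p : ℕ) : Measurable (haar k p) :=
  ((measurable_one.indicator measurableSet_Ico).neg).add
    (measurable_one.indicator measurableSet_Ico)

theorem IsRFunction.measurable {r : Fin d → ℕ} {f : (Fin d → ℝ) → ℝ} (hf : IsRFunction r f) :
    Measurable f := by
  obtain ⟨ε, -, hf⟩ := hf
  rw [funext hf]
  refine Finset.measurable_fun_sum _ fun R _ => Measurable.const_mul ?_ _
  exact Finset.measurable_fun_prod _ fun l _ => (measurable_haar _ _).comp (measurable_pi_apply l)

theorem IsRFunction.abs_le_one {r : Fin d → ℕ} {f : (Fin d → ℝ) → ℝ} (hf : IsRFunction r f)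
    (x : Fin d → ℝ) : |f x| ≤ 1 := by
  obtain ⟨ε, hε, hf⟩ := hf
  rw [hf]
  refine (Finset.abs_sum_le_sum_abs _ _).trans ?_
  have h1 : ∀ R : Rect r, |ε R * haarRect r R x| = ∏ l, |haar (r l) (R l) (x l)| := by
    intro R
    rw [abs_mul, haarRect, Finset.abs_prod]
    rcases hε R with h | h <;> simp [h]
  simp only [h1]
  have h2 := Finset.prod_univ_sum (t := fun l => (Finset.univ : Finset (Fin (2 ^ r l))))
    (f := fun l p => |haar (r l) p (x l)|)
  rw [Fintype.piFinset_univ] at h2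
  rw [← h2]
  exact Finset.prod_le_one (fun l _ => Finset.sum_nonneg fun p _ => abs_nonneg _)
    fun l _ => sum_abs_haar_le_one _ _

theorem IsRFunction.coordFlip_of_lt {r : Fin d → ℕ} {f : (Fin d → ℝ) → ℝ} (hf : IsRFunction r f)
    {i : Fin d} {m : ℕ} (h : r i < m) (x : Fin d → ℝ) : f (coordFlip i m x) = f x := by
  obtain ⟨ε, -, hf⟩ := hf
  rw [hf, hf]
  exact Finset.sum_congr rfl fun R _ => by rw [haarRect_coordFlip_of_lt R h]

theorem IsRFunction.coordFlip_self {r : Fin d → ℕ} {f : (Fin d → ℝ) → ℝ} (hf : IsRFunction r f)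
    (i : Fin d) (x : Fin d → ℝ) : f (coordFlip i (r i) x) = -f x := by
  obtain ⟨ε, -, hf⟩ := hf
  rw [hf, hf, ← Finset.sum_neg_distrib]
  exact Finset.sum_congr rfl fun R _ => by rw [haarRect_coordFlip_self, mul_neg]

-- Extension by zero to all indices is consistent, as the zero function is both invariant and odd.
open Classical in
theorem haarSystem_of_isRFunction {n : ℕ} {f : (Fin d → ℕ) → (Fin d → ℝ) → ℝ}
    (hf : ∀ r ∈ hyperbolic d n, IsRFunction r (f r)) :
    HaarSystem ((volume : Measure (Fin d → ℝ)).restrict (Set.Icc 0 1))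
      (fun r => if r ∈ hyperbolic d n then f r else 0) coordFlip where
  measurable r := by
    split_ifs with h
    · exact (hf r h).measurable
    · exact measurable_zero
  abs_le_one r x := by
    split_ifs with h
    · exact (hf r h).abs_le_one x
    · simp
  preserving := measurePreserving_coordFlip
  invariant r i m x hm := by
    split_ifs with h
    · exact (hf r h).coordFlip_of_lt hm x
    · rfl
  odd r i x := by
    split_ifs with h
    · exact (hf r h).coordFlip_self i x
    · simp

end Cube

/-! ### From admissible graphs to clique relations. -/

namespace ColoredGraph

variable {d q : ℕ}

/-- The edge relations of a colored graph, indexed by all coordinates. -/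
def adj (G : ColoredGraph d q) (i : Fin d) (v w : G.V) : Prop :=
  ∃ h : (i : ℕ) ≠ 0, (G.edges ⟨i, h⟩).Adj v w

theorem exists_isColorClique_of_adj (G : ColoredGraph d q) {j : Color d} {v w : G.V}
    (h : (G.edges j).Adj v w) : ∃ Q, G.IsColorClique j Q ∧ v ∈ Q ∧ w ∈ Q := by
  have h1 : (G.edges j).IsClique {v, w} := by
    rw [SimpleGraph.isClique_pair]
    exact fun _ => h
  obtain ⟨Q, hQ, hmax⟩ := Set.Finite.exists_le_maximal
    (Set.toFinite {Q : Set G.V | (G.edges j).IsClique Q}) h1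
  exact ⟨Q, hmax, hQ (by simp), hQ (by simp)⟩

/-- For transitivity, the maximal cliques containing two consecutive edges share the middle vertex,
so disjointness forces them to be equal. -/
theorem Admissible.cliqueRelations {G : ColoredGraph d q} (hG : G.Admissible) :
    CliqueRelations G.adj where
  symm := by
    rintro i v w ⟨h, hvw⟩
    exact ⟨h, hvw.symm⟩
  irrefl := by
    rintro i v ⟨h, hv⟩
    exact (G.edges _).irrefl hv
  trans := by
    rintro i u v w ⟨h, huv⟩ ⟨_, hvw⟩ huw
    obtain ⟨Q, hQ, huQ, hvQ⟩ := G.exists_isColorClique_of_adj huv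
    obtain ⟨Q', hQ', hvQ', hwQ'⟩ := G.exists_isColorClique_of_adj hvw
    have hQQ : Q = Q' := by
      by_contra hne
      exact Set.disjoint_left.1 (hG.decompose _ Q Q' hQ hQ' hne) hvQ hvQ'
    subst hQQ
    exact ⟨h, hQ.1 huQ hwQ' huw⟩

theorem Admissible.exists_adj {G : ColoredGraph d q} (hG : G.Admissible) (v : G.V) :
    ∃ i w, G.adj i v w := by
  obtain ⟨⟨i, hi⟩, Q, hQ, hnt, hv⟩ := hG.covered v
  obtain ⟨w, hw, hwv⟩ := hnt.exists_ne v
  exact ⟨i, w, hi, hQ.1 hv hw hwv.symm⟩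

theorem tuples_eq (G : ColoredGraph d q) (n : ℕ) (I : Fin q → Finset ℕ) :
    G.tuples n I = coincidenceTuples G.adj fun v => blockVectors d n I v := by
  ext r
  simp only [tuples, coincidenceTuples, Finset.mem_filter, Fintype.mem_piFinset]
  refine and_congr_right fun _ => ⟨?_, ?_⟩
  · rintro h i v w ⟨hi, hvw⟩
    exact h ⟨i, hi⟩ v w hvw
  · rintro h ⟨i, hi⟩ v w hvw
    exact h i v w ⟨hi, hvw⟩

end ColoredGraph

/-- The numerical comparison: `k` is an exponent of the order `N ^ 2 * p`. -/
theorem rho_pow_mul_le {d n q N k : ℕ} (hd : 3 ≤ d) (hn : 1 ≤ n) {p : ℝ} (hp : 2 < p)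
    (hk : (k : ℝ) ≤ 8 * N ^ 2 * p) (hN : 1 ≤ N) (hk0 : 1 ≤ k) :
    rho d n q ^ N * (Real.sqrt (((8 * (k : ℝ) + 1) * (n + 1)) ^ ((d - 1) * N)) *
        ((n : ℝ) + 1) ^ (-(N / (8 * ((d : ℝ) - 1))))) ≤
      ((144 : ℝ) ^ (((d : ℝ) - 1) / 2) * (N : ℝ) ^ ((d : ℝ) - 1) * p ^ (((d : ℝ) - 1) / 2) *
        (q : ℝ) ^ (1 / 2 : ℝ) * (n : ℝ) ^ (-(1 / (16 * (d : ℝ))))) ^ N := by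
  have hd' : (3 : ℝ) ≤ d := by exact_mod_cast hd
  have hn' : (1 : ℝ) ≤ n := by exact_mod_cast hn
  have hN' : (1 : ℝ) ≤ N := by exact_mod_cast hN
  have hk' : (1 : ℝ) ≤ k := by exact_mod_cast hk0
  have hn0 : (0 : ℝ) < n := by linarith
  have hN0 : (0 : ℝ) ≤ N := by linarith
  have hp0 : 0 ≤ p := by linarith
  set e : ℝ := ((d : ℝ) - 1) / 2 with he
  have he0 : 0 ≤ e := by rw [he]; linarith
  -- `144 = 9 * 8 * 2`, from `8k + 1 ≤ 9k`, `k ≤ 8 N² p` and `n + 1 ≤ 2n`.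
  have hT : (8 * (k : ℝ) + 1) * (n + 1) ≤ 144 * (N ^ 2 * p * n) := by
    calc (8 * (k : ℝ) + 1) * (n + 1) ≤ (9 * (8 * N ^ 2 * p)) * (2 * n) := by
          gcongr
          · linarith
          · linarith
      _ = _ := by ring
  have h1 : Real.sqrt (((8 * (k : ℝ) + 1) * (n + 1)) ^ ((d - 1) * N)) ≤
      ((144 : ℝ) ^ e * (N : ℝ) ^ ((d : ℝ) - 1) * p ^ e * (n : ℝ) ^ e) ^ N := by
    have h2 : ((d - 1 : ℕ) : ℝ) = 2 * e := by
      rw [Nat.cast_sub (by omega), he]; push_cast; ring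
    have h3 : (N : ℝ) ^ ((d : ℝ) - 1) = ((N : ℝ) ^ 2) ^ e := by
      rw [← Real.rpow_natCast, ← Real.rpow_mul hN0, he]
      congr 1; push_cast; ring
    rw [h3, ← Real.mul_rpow (by norm_num) (by positivity),
      ← Real.mul_rpow (by positivity) hp0, ← Real.mul_rpow (by positivity) hn0.le,
      Real.sqrt_eq_rpow, ← Real.rpow_natCast, ← Real.rpow_natCast, ← Real.rpow_mul (by positivity),
      ← Real.rpow_mul (by positivity)]
    have h4 : (((d - 1) * N : ℕ) : ℝ) * (1 / 2) = e * N := by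
      push_cast
      rw [h2]; ring
    rw [h4]
    refine Real.rpow_le_rpow (by positivity) (hT.trans (le_of_eq (by ring))) (by positivity)
  have h5 : ((n : ℝ) + 1) ^ (-(N / (8 * ((d : ℝ) - 1)))) ≤
      ((n : ℝ) ^ (-(1 / (16 * (d : ℝ))))) ^ N := by
    rw [← Real.rpow_natCast, ← Real.rpow_mul hn0.le]
    have h6 : 0 ≤ (N : ℝ) / (8 * ((d : ℝ) - 1)) := div_nonneg hN0 (by linarith)
    refine (Real.rpow_le_rpow_of_nonpos hn0 (by linarith) (by linarith)).trans ?_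
    refine Real.rpow_le_rpow_of_exponent_le hn' ?_
    rw [neg_mul, neg_le_neg_iff, div_mul_eq_mul_div, one_mul]
    exact div_le_div_of_nonneg_left hN0 (by linarith) (by linarith)
  -- The normalization cancels the benchmark power of `n` exactly and leaves `√q` per vertex.
  have h7 : rho d n q ^ N * ((n : ℝ) ^ e) ^ N = ((q : ℝ) ^ (1 / 2 : ℝ)) ^ N := by
    rw [← mul_pow, rho, mul_assoc, ← Real.rpow_add hn0, Real.sqrt_eq_rpow]
    rw [show -(((d : ℝ) - 1) / 2) + e = 0 by rw [he]; ring, Real.rpow_zero, mul_one]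
  have hrho : 0 ≤ rho d n q ^ N := by
    unfold rho
    positivity
  calc _ ≤ rho d n q ^ N * (((144 : ℝ) ^ e * (N : ℝ) ^ ((d : ℝ) - 1) * p ^ e * (n : ℝ) ^ e) ^ N *
        ((n : ℝ) ^ (-(1 / (16 * (d : ℝ))))) ^ N) := by gcongr
    _ = (rho d n q ^ N * ((n : ℝ) ^ e) ^ N) * ((144 : ℝ) ^ e * (N : ℝ) ^ ((d : ℝ) - 1) * p ^ e) ^ N
        * ((n : ℝ) ^ (-(1 / (16 * (d : ℝ))))) ^ N := by rw [mul_pow _ ((n : ℝ) ^ e)]; ring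
    _ = _ := by rw [h7]; ring

end BeckGain

/-! ### The main theorem. -/

theorem mainTheorem7 (d : ℕ) (hd : 3 ≤ d) :
    ∃ C₀ C₁ C₂ C₃ : ℝ, 0 < C₀ ∧ 0 < C₁ ∧ 0 < C₂ ∧ 0 < C₃ ∧
      ∀ n q : ℕ, 1 ≤ q → q ≤ n →
      ∀ I : Fin q → Finset ℕ, BeckGain.IsEqualDivision n q I →
      ∀ f : (Fin d → ℕ) → (Fin d → ℝ) → ℝ,
        (∀ r ∈ BeckGain.hyperbolic d n, BeckGain.IsRFunction r (f r)) →
      ∀ G : BeckGain.ColoredGraph d q, G.Admissible →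
      ∀ p : ℝ, 2 < p →
        ENNReal.ofReal (BeckGain.rho d n q ^ G.V.card) *
            eLpNorm (BeckGain.sumProd f (G.tuples n I)) (ENNReal.ofReal p)
              (volume.restrict (Set.Icc (0 : Fin d → ℝ) 1)) ≤
          ENNReal.ofReal
            ((C₀ * (G.V.card : ℝ) ^ C₁ * p ^ C₂ * (q : ℝ) ^ C₃ *
              (n : ℝ) ^ (-(1 / (16 * (d : ℝ))))) ^ G.V.card) := by
  classical
  have hd' : (3 : ℝ) ≤ d := by exact_mod_cast hd
  refine ⟨(144 : ℝ) ^ (((d : ℝ) - 1) / 2), (d : ℝ) - 1, ((d : ℝ) - 1) / 2, 1 / 2, by positivity,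
    by linarith, by linarith, by norm_num, ?_⟩
  intro n q hq hqn I hI f hf G hG p hp
  have hprob := BeckGain.isProbabilityMeasure_cube (d := d)
  have H := BeckGain.haarSystem_of_isRFunction hf
  set N := G.V.card with hN
  have hcard : Fintype.card G.V = N := Fintype.card_coe _
  -- Large enough for both applications of Hölder, and polynomial in `N` and `p`.
  set k := ⌈((N : ℝ) + 1) ^ 2 * p⌉₊ with hk
  have hk1 : ((N : ℝ) + 1) ^ 2 * p ≤ k := Nat.le_ceil _
  have hk0 : 0 < k := Nat.ceil_pos.2 (by positivity)
  have hblock : ∀ (t : Fin q), ∀ r ∈ BeckGain.blockVectors d n I t,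
      r ∈ BeckGain.hyperbolic d n := fun t r hr => (Finset.mem_filter.1 hr).1
  have hfun : BeckGain.sumProd f (G.tuples n I) = fun x =>
      ∑ r ∈ BeckGain.coincidenceTuples G.adj (fun v => BeckGain.blockVectors d n I v),
        ∏ v, (if r v ∈ BeckGain.hyperbolic d n then f (r v) else 0) x := by
    funext x
    rw [BeckGain.sumProd, BeckGain.ColoredGraph.tuples_eq]
    refine Finset.sum_congr rfl fun r hr => Finset.prod_congr rfl fun v _ => ?_
    simp only [BeckGain.coincidenceTuples, Finset.mem_filter, Fintype.mem_piFinset] at hr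
    rw [if_pos (hblock _ _ (hr.1 v))]
  have hp1 : (1 : ℝ≥0∞) ≤ ENNReal.ofReal p := by
    rw [← ENNReal.ofReal_one]
    exact ENNReal.ofReal_le_ofReal (by linarith)
  have hmain := BeckGain.eLpNorm_coincidence_le H (k := k) (n := n) hk0.ne' (by omega : 2 ≤ d)
    (i := ⟨0, by omega⟩) (A := fun v : G.V => BeckGain.blockVectors d n I v) (adj := G.adj)
    (fun v r hr => by
      have := hblock _ r hr
      simpa [BeckGain.hyperbolic] using this)
    (fun v w hvw r hr s hs => hI.ordered v w hvw _ ((Finset.mem_filter.1 hr).2 _ rfl) _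
      ((Finset.mem_filter.1 hs).2 _ rfl))
    hG.cliqueRelations (fun v w => fun ⟨h, _⟩ => h rfl) hG.exists_adj hp1
    (by
      rw [hcard, ← ENNReal.ofReal_natCast, ← ENNReal.ofReal_natCast,
        ← ENNReal.ofReal_mul (by positivity)]
      refine ENNReal.ofReal_le_ofReal ?_
      push_cast
      linarith [(Nat.cast_nonneg k : (0 : ℝ) ≤ k)])
  rw [hcard] at hmain
  rw [hfun]
  have hrho : 0 ≤ BeckGain.rho d n q ^ N := by
    unfold BeckGain.rho
    positivity
  refine (mul_le_mul_right hmain _).trans ?_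
  rw [← ENNReal.ofReal_mul hrho]
  refine ENNReal.ofReal_le_ofReal ?_
  -- The empty graph is treated apart, because `k ≤ 8 N² p` fails for `N = 0`.
  rcases Nat.eq_zero_or_pos N with h0 | hpos
  · simp [h0]
  · refine BeckGain.rho_pow_mul_le hd (hq.trans hqn) hp ?_ hpos hk0
    have h1 : (k : ℝ) < ((N : ℝ) + 1) ^ 2 * p + 1 := Nat.ceil_lt_add_one (by positivity)
    have h2 : (1 : ℝ) ≤ N := by exact_mod_cast hpos
    have h3 : ((N : ℝ) + 1) ^ 2 * p ≤ 4 * N ^ 2 * p := by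
      have : ((N : ℝ) + 1) ^ 2 ≤ 4 * N ^ 2 := by nlinarith
      gcongr
    have h4 : 1 ≤ (N : ℝ) ^ 2 * p := by nlinarith
    linarith
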